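/- Let $\mathcal X\neq\emptyset$ and $\mathcal Y$ be measurable spaces and let $W=(W_x)_{x\in\mathcal X}$ and $\overline W=(\overline W_x)_{x\in\mathcal X}$ be two channels (Markov kernels) from $\mathcal X$ to $\mathcal Y$. For probability measures $P,\overline P$ on the same space put $$\Phi(s|P\|\overline P)=\int\Bigl(\frac{d\overline P}{dP}\Bigr)^{s}dP\in[0,\infty],\qquad \phi(s|P\|\overline P)=\log\Phi(s|P\|\overline P)$$ (with the derivative of the absolutely continuous part of $\overline P$, and $0^s=\infty$ for $s<0$). For a distribution $P$ on $\mathcal X$ let $WP(dx,dy)=P(dx)W_x(dy)$, and put $\phi(s|W\|\overline W|P)=\phi(s|WP\|\overline WP)$ and $\phi(s|W\|\overline W)=\sup_{x\in\mathcal X}\phi(s|W_x\|\overline W_x)\in(-\infty,\infty]$ for $s\le 0$. Let $\mathcal P(\mathcal X)$ be the set of all distributions on $\mathcal X$ and $\mathcal P^2(\mathcal X)$ the set of those supported on at most two points, that is, of the form $\lambda\delta_x+(1-\lambda)\delta_{x'}$ with $\lambda\in[0,1]$. An adaptive method for $n$ uses of the channel consists of $\vec P^n=(P^1,\dots,P^n)$,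 where $P^k$ is a Markov kernel giving the law of the $k$-th input $x_k$ conditionally on $(x_1,y_1),\dots,(x_{k-1},y_{k-1})$, and of a measurable test $f_n:(\mathcal X\times\mathcal Y)^n\to[0,1]$. Let $Q_{W,\vec P^n}$ be the resulting law of $(x_1,y_1,\dots,x_n,y_n)$ when the channel is $W$, i.e. $y_k$ has conditional law $W_{x_k}$. For $r\in\mathbb R$ define $$B_e^*(r|W\|\overline W)=\inf_{\{(\vec P^n,f_n)\}_n}\Bigl\{\liminf_{n\to\infty}\frac{-\log \mathrm E_{Q_{W,\vec P^n}}(1-f_n)}{n}\ \Big|\ \liminf_{n\to\infty}\frac{-\log \mathrm E_{Q_{\overline W,\vec P^n}}(1-f_n)}{n}\ge r\Bigr\},$$ where $-\log 0=\infty$. Assume that for every $x\in\mathcal X$ the function $s\mapsto\phi(s|W_x\|\overline W_x)$ is finite and $C^1$ on $(-\infty,0]$ (with the one-sided derivative at $0$). Then for every $r\in\mathbb R$ $$B_e^*(r|W\|\overline W)=\sup_{s\le0}\frac{-sr-\phi(s|W\|\overline W)}{1-s}=\inf_{P\in\mathcal P(\mathcal X)}\sup_{s\le0}\frac{-sr-\phi(s|W\|\overline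 W|P)}{1-s}=\inf_{P\in\mathcal P^2(\mathcal X)}\sup_{s\le0}\frac{-sr-\phi(s|W\|\overline W|P)}{1-s}.$$ Moreover stochastic non-adaptive methods are optimal: $B_e^*(r|W\|\overline W)$ is unchanged if the infimum defining it is restricted to those sequences of methods whose inputs $x_1,\dots,x_n$ are, for every $n$, independent with one common law $P\in\mathcal P^2(\mathcal X)$ (the same $P$ for all $n$). -/

import Mathlib

open MeasureTheory ProbabilityTheory Filter Set
open scoped ENNReal

noncomputable section

namespace ChannelDiscrimination

/-- `Φ(s|P‖P̄) = ∫ (dP̄/dP)^s dP`, with values in `[0, ∞]` (and `0 ^ s = ∞` for `s < 0`). -/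
def Phi {Z : Type*} [MeasurableSpace Z] (s : ℝ) (P Pbar : Measure Z) : ℝ≥0∞ :=
  ∫⁻ z, (Pbar.rnDeriv P z) ^ s ∂P

/-- `φ(s|P‖P̄) = log Φ(s|P‖P̄)`, with values in `[-∞, ∞]`. -/
def phi {Z : Type*} [MeasurableSpace Z] (s : ℝ) (P Pbar : Measure Z) : EReal :=
  ENNReal.log (Phi s P Pbar)

section Channels

variable {X Y : Type*} [MeasurableSpace X] [MeasurableSpace Y]

/-- `φ(s|W‖W̄)`: the supremum over the inputs `x` of `φ(s|W_x‖W̄_x)`. -/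
def phiSup (s : ℝ) (W Wbar : Kernel X Y) : EReal :=
  ⨆ x : X, phi s (W x) (Wbar x)

/-- `φ(s|W‖W̄|P) = φ(s|WP‖W̄P)`, where `WP` is the joint law of input and output. -/
def phiInput (s : ℝ) (W Wbar : Kernel X Y) (P : ProbabilityMeasure X) : EReal :=
  phi s ((P : Measure X) ⊗ₘ W) ((P : Measure X) ⊗ₘ Wbar)

/-- The probability distributions on `X` that are supported on at most two points. -/
def twoPoint (X : Type*) [MeasurableSpace X] : Set (ProbabilityMeasure X) :=
  {P | ∃ x x' : X, ∃ t ∈ Icc (0 : ℝ) 1, (P : Measure X) =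
    ENNReal.ofReal t • Measure.dirac x + ENNReal.ofReal (1 - t) • Measure.dirac x'}

/-- `sup_{s ≤ 0} (-s r - ψ(s)) / (1 - s)`. -/
def hanKobayashi (r : ℝ) (ψ : ℝ → EReal) : EReal :=
  ⨆ (s : ℝ) (_ : s ≤ 0), (((-s * r : ℝ) : EReal) - ψ s) / ((1 - s : ℝ) : EReal)

/-- An adaptive choice of `n` inputs: conditional distributions `(P¹, …, Pⁿ)`, where `Pᵏ` is the
law of the `k`-th input given the preceding `k - 1` pairs of input and output. -/
inductive AdaptiveInput (X Y : Type*) [MeasurableSpace X] [MeasurableSpace Y] : ℕ → Type _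
  | nil : AdaptiveInput X Y 0
  | snoc {n : ℕ} (p : AdaptiveInput X Y n) (κ : Kernel (Fin n → X × Y) X)
      (hκ : IsMarkovKernel κ) : AdaptiveInput X Y (n + 1)

/-- The law `Q_{W,P⃗ⁿ}` of the `n` pairs of input and output when the channel is `W`. -/
def AdaptiveInput.law (W : Kernel X Y) : {n : ℕ} → AdaptiveInput X Y n → Measure (Fin n → X × Y)
  | _, .nil => Measure.dirac Fin.elim0
  | n + 1, .snoc p κ _ =>
      (p.law W ⊗ₘ (κ ⊗ₖ Kernel.prodMkLeft (Fin n → X × Y) W)).map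
        (fun z => (Fin.snoc z.1 z.2 : Fin (n + 1) → X × Y))

/-- The stochastic non-adaptive choice of `n` inputs: independent inputs with common law `P`. -/
def AdaptiveInput.iid (Y : Type*) [MeasurableSpace Y] (P : ProbabilityMeasure X) :
    (n : ℕ) → AdaptiveInput X Y n
  | 0 => .nil
  | n + 1 => .snoc (AdaptiveInput.iid Y P n) (Kernel.const _ (P : Measure X)) inferInstance

/-- A decision method `(P⃗ⁿ, f_n)` for `n` uses: an adaptive choice of the inputs and a randomized
test `f_n`, which accepts the alternative hypothesis `W̄` with probability `f_n`. -/
structure Method (X Y : Type*) [MeasurableSpace X] [MeasurableSpace Y] (n : ℕ) where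
  input : AdaptiveInput X Y n
  test : (Fin n → X × Y) → ℝ
  measurable_test : Measurable test
  test_mem : ∀ z, test z ∈ Icc (0 : ℝ) 1

/-- `E_{Q_{W,P⃗ⁿ}} (1 - f_n)`: the probability of accepting the null hypothesis when the channel
is `W`. -/
def Method.acceptNull {n : ℕ} (M : Method X Y n) (W : Kernel X Y) : ℝ≥0∞ :=
  ∫⁻ z, ENNReal.ofReal (1 - M.test z) ∂(M.input.law W)

/-- `liminf_n -(1/n) log E_{Q_{W,P⃗ⁿ}} (1 - f_n)`, with `-log 0 = ∞`. -/
def rate (M : ∀ n, Method X Y n) (W : Kernel X Y) : EReal :=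
  liminf (fun n : ℕ => -ENNReal.log ((M n).acceptNull W) / (n : EReal)) atTop

/-- `B_e^*(r|W‖W̄)`: the strong converse exponent over adaptive methods. -/
def strongConverseExponent (r : ℝ) (W Wbar : Kernel X Y) : EReal :=
  ⨅ (M : ∀ n, Method X Y n) (_ : (r : EReal) ≤ rate M Wbar), rate M W

/-- The same exponent when the inputs are restricted to be independent with a common law `P`. -/
def nonAdaptiveExponent (r : ℝ) (W Wbar : Kernel X Y) (P : ProbabilityMeasure X) : EReal :=
  ⨅ (M : ∀ n, Method X Y n) (_ : ∀ n, (M n).input = AdaptiveInput.iid Y P n)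
    (_ : (r : EReal) ≤ rate M Wbar), rate M W

/-- The map appending the `n + 1`-st pair, used in `AdaptiveInput.law`, is measurable. -/
theorem measurable_snoc (n : ℕ) : Measurable
    (fun z : (Fin n → X × Y) × (X × Y) => (Fin.snoc z.1 z.2 : Fin (n + 1) → X × Y)) := by
  refine measurable_pi_lambda _ fun i => ?_
  refine Fin.lastCases ?_ (fun j => ?_) i
  · simpa using measurable_snd
  · simp only [Fin.snoc_castSucc]
    exact (measurable_pi_apply j).comp measurable_fst

/-- `Q_{W,P⃗ⁿ}` is a probability measure. -/
theorem AdaptiveInput.isProbabilityMeasure_law (W : Kernel X Y) [IsMarkovKernel W] {n : ℕ}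
    (p : AdaptiveInput X Y n) : IsProbabilityMeasure (p.law W) := by
  induction p with
  | nil => unfold AdaptiveInput.law; infer_instance
  | snoc p κ hκ ih =>
    unfold AdaptiveInput.law
    exact Measure.isProbabilityMeasure_map (measurable_snoc _).aemeasurable

end Channels

end ChannelDiscrimination

end

open ChannelDiscrimination

/-! Lower bound. For `s < 0` put `θ = -s / (1 - s)`, which lies in `(0, 1)`. Finiteness of
`Φ(s|μ‖ν)` is equivalent, by Hölder duality and with the same optimal constant, to the inequality `∫
g dμ ≤ Φ ^ (1 - θ) * (∫ g ^ (1/θ) dν) ^ θ` for all `g ≥ 0`. In this form the bound composes along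
kernels, the constants multiplying (`HolderDominated.compProd`). The input kernels are the same
under both hypotheses and contribute the constant `1`, so `n` adaptive uses cost at most `(sup_x Φ)
^ n`. Taking `g = 1 - f_n` gives the exponent bound `hanKobayashi_phiSup_le_rate`; one step of the
same argument gives `phiInput ≤ phiSup`.

Upper bound. The Han–Kobayashi value is at most `V` exactly when `ψ` lies on `s ≤ 0` above the line
through `(0, -V)` and `(1, -r)` (`hanKobayashi_le_iff`). For a fixed input law, some tangent of the
cumulant generating function almost has the required position with respect to this line, and the
typical set of the measure tilted at the point of tangency, accepted with a suitable exponentially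
small probability, realizes the exponent (`nonAdaptiveExponent_le`).

Two inputs suffice by a one-dimensional Helly argument. If the supremum of the convex functions
`φ(·|W_x‖W̄_x)` is above the line, then for every `V' > V` the intervals where the single functions
are below the line for `V'` have no common point, so two of them are disjoint
(`exists_disjoint_sublevel`). A convex combination of the two functions is then above the line
(`exists_convexCombination_line_le`), and by convexity of `exp` so is `φ` of the corresponding
two-point mixture. -/

namespace ChannelDiscrimination

/-- `μ` is dominated by `ν` in the sense of Hölder's inequality with exponent `θ` and constant
`C`. For `θ = -s / (1 - s)` this is the dual form of `Phi s μ ν ≤ C`. -/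
def HolderDominated {Z : Type*} [MeasurableSpace Z] (θ : ℝ) (C : ℝ≥0∞) (μ ν : Measure Z) : Prop :=
  ∀ g : Z → ℝ≥0∞, Measurable g →
    ∫⁻ z, g z ∂μ ≤ C ^ (1 - θ) * (∫⁻ z, g z ^ θ⁻¹ ∂ν) ^ θ

/-! ### Hölder domination as the dual form of `Phi` -/

section Holder

variable {Z Z' : Type*} [MeasurableSpace Z] [MeasurableSpace Z']
  {θ s : ℝ} {C C' : ℝ≥0∞} {μ ν : Measure Z}

theorem lintegral_mul_le_of_add_eq_one (μ : Measure Z) (h0 : 0 < θ) (h1 : θ < 1)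
    {f g : Z → ℝ≥0∞} (hf : Measurable f) (hg : Measurable g) :
    ∫⁻ z, f z * g z ∂μ ≤
      (∫⁻ z, g z ^ (1 - θ)⁻¹ ∂μ) ^ (1 - θ) * (∫⁻ z, f z ^ θ⁻¹ ∂μ) ^ θ := by
  have h := ENNReal.lintegral_mul_le_Lp_mul_Lq μ
    (Real.HolderConjugate.inv_inv h0 (sub_pos.2 h1) (by ring)) hf.aemeasurable hg.aemeasurable
  simp only [one_div, inv_inv] at h
  rw [mul_comm]
  exact h

theorem HolderDominated.mono (h : HolderDominated θ C μ ν) (h1 : θ ≤ 1) (hC : C ≤ C') :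
    HolderDominated θ C' μ ν := fun g hg =>
  (h g hg).trans (mul_le_mul_left (ENNReal.rpow_le_rpow hC (sub_nonneg.2 h1)) _)

theorem HolderDominated.refl (h0 : 0 < θ) (h1 : θ < 1) (μ : Measure Z) [IsProbabilityMeasure μ] :
    HolderDominated θ 1 μ μ := fun g hg => by
  simpa using lintegral_mul_le_of_add_eq_one μ h0 h1 hg (measurable_const (a := (1 : ℝ≥0∞)))

theorem HolderDominated.map (h : HolderDominated θ C μ ν) {f : Z → Z'} (hf : Measurable f) :
    HolderDominated θ C (μ.map f) (ν.map f) := fun g hg => by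
  rw [lintegral_map hg hf, lintegral_map (hg.pow_const _) hf]
  exact h _ (hg.comp hf)

/-- The fibrewise bound produces the function `(∫ g ^ (1/θ) dL) ^ θ`; its power `1/θ` is again the
inner integral, so the bound for the base measures applies to it without loss. -/
theorem HolderDominated.compProd [SFinite μ] [SFinite ν] {K L : Kernel Z Z'} [IsSFiniteKernel K]
    [IsSFiniteKernel L] (h0 : 0 < θ) (h1 : θ ≤ 1) (h : HolderDominated θ C μ ν)
    (hK : ∀ z, HolderDominated θ C' (K z) (L z)) :
    HolderDominated θ (C * C') (μ ⊗ₘ K) (ν ⊗ₘ L) := fun g hg => by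
  have hg' : Measurable fun p => g p ^ θ⁻¹ := hg.pow_const _
  have hm : Measurable fun z => ∫⁻ y, g (z, y) ^ θ⁻¹ ∂L z := hg'.lintegral_kernel_prod_right'
  rw [Measure.lintegral_compProd hg, Measure.lintegral_compProd hg']
  calc ∫⁻ z, ∫⁻ y, g (z, y) ∂K z ∂μ
      ≤ ∫⁻ z, C' ^ (1 - θ) * (∫⁻ y, g (z, y) ^ θ⁻¹ ∂L z) ^ θ ∂μ :=
        lintegral_mono fun z => hK z _ (hg.comp measurable_prodMk_left)
    _ = C' ^ (1 - θ) * ∫⁻ z, (∫⁻ y, g (z, y) ^ θ⁻¹ ∂L z) ^ θ ∂μ :=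
        lintegral_const_mul _ (hm.pow_const _)
    _ ≤ C' ^ (1 - θ) * (C ^ (1 - θ) * (∫⁻ z, ((∫⁻ y, g (z, y) ^ θ⁻¹ ∂L z) ^ θ) ^ θ⁻¹ ∂ν) ^ θ) :=
        mul_le_mul_right (h _ (hm.pow_const _)) _
    _ = _ := by
        simp only [ENNReal.rpow_rpow_inv h0.ne']
        rw [ENNReal.mul_rpow_of_nonneg _ _ (sub_nonneg.2 h1)]
        ring

theorem theta_pos (hs : s < 0) : 0 < -s / (1 - s) := div_pos (by linarith) (by linarith)

theorem theta_lt_one (hs : s < 0) : -s / (1 - s) < 1 := by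
  rw [div_lt_one (by linarith)]; linarith

theorem rnDeriv_ne_zero_of_Phi [SigmaFinite μ] (hs : s < 0) (hΦ : Phi s μ ν < ⊤) :
    ∀ᵐ z ∂μ, ν.rnDeriv μ z ≠ 0 := by
  filter_upwards [ae_lt_top ((Measure.measurable_rnDeriv ν μ).pow_const s) hΦ.ne] with z hz h0
  simp [h0, ENNReal.zero_rpow_of_neg hs] at hz

/-- Insert `1 = D ^ θ * D ^ (-θ)` with `D = dν/dμ` and apply Hölder: `-θ / (1 - θ) = s` turns the
second factor into `Phi`, and the first becomes an integral against the absolutely continuous part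
of `ν`. -/
theorem holderDominated_Phi [SigmaFinite μ] [SigmaFinite ν] (hs : s < 0)
    (hΦ : Phi s μ ν < ⊤) : HolderDominated (-s / (1 - s)) (Phi s μ ν) μ ν := fun g hg => by
  set θ := -s / (1 - s) with hθ
  have h0 : 0 < θ := theta_pos hs
  have h1 : θ < 1 := theta_lt_one hs
  set D := ν.rnDeriv μ with hD
  have hDm : Measurable D := Measure.measurable_rnDeriv ν μ
  have hθs : -θ * (1 - θ)⁻¹ = s := by
    have : 1 - s ≠ 0 := by linarith
    rw [hθ]; field_simp; ring
  calc ∫⁻ z, g z ∂μ = ∫⁻ z, (g z * D z ^ θ) * D z ^ (-θ) ∂μ := by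
        refine lintegral_congr_ae ?_
        filter_upwards [rnDeriv_ne_zero_of_Phi hs hΦ, ν.rnDeriv_lt_top μ] with z hz hz'
        rw [mul_assoc, ← ENNReal.rpow_add _ _ hz hz'.ne]
        simp
    _ ≤ (∫⁻ z, (D z ^ (-θ)) ^ (1 - θ)⁻¹ ∂μ) ^ (1 - θ) *
          (∫⁻ z, (g z * D z ^ θ) ^ θ⁻¹ ∂μ) ^ θ :=
        lintegral_mul_le_of_add_eq_one μ h0 h1 (hg.mul (hDm.pow_const _)) (hDm.pow_const _)
    _ ≤ Phi s μ ν ^ (1 - θ) * (∫⁻ z, g z ^ θ⁻¹ ∂ν) ^ θ := by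
        have hΦ' : ∫⁻ z, (D z ^ (-θ)) ^ (1 - θ)⁻¹ ∂μ = Phi s μ ν := by
          simp only [← ENNReal.rpow_mul, hθs, Phi, hD]
        rw [hΦ']
        refine mul_le_mul_right (ENNReal.rpow_le_rpow ?_ h0.le) _
        calc ∫⁻ z, (g z * D z ^ θ) ^ θ⁻¹ ∂μ = ∫⁻ z, (D * fun z => g z ^ θ⁻¹) z ∂μ := by
              refine lintegral_congr fun z => ?_
              rw [ENNReal.mul_rpow_of_nonneg _ _ (inv_nonneg.2 h0.le),
                ENNReal.rpow_rpow_inv h0.ne', mul_comm]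
              rfl
          _ = ∫⁻ z, g z ^ θ⁻¹ ∂(μ.withDensity D) :=
              (lintegral_withDensity_eq_lintegral_mul μ hDm (hg.pow_const _)).symm
          _ ≤ _ := lintegral_mono' (Measure.withDensity_rnDeriv_le ν μ) le_rfl

theorem exists_measurableSet_restrict_eq_withDensity (μ ν : Measure Z) [SigmaFinite μ]
    [SigmaFinite ν] : ∃ S, MeasurableSet S ∧ μ Sᶜ = 0 ∧
      ν.restrict S = μ.withDensity (ν.rnDeriv μ) := by
  have h := Measure.mutuallySingular_singularPart ν μ
  refine ⟨h.nullSet, h.measurableSet_nullSet, h.measure_compl_nullSet, ?_⟩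
  refine (congrArg (fun m : Measure Z => m.restrict h.nullSet)
    (Measure.haveLebesgueDecomposition_add ν μ)).trans ?_
  rw [Measure.restrict_add, h.restrict_nullSet, zero_add,
    restrict_withDensity h.measurableSet_nullSet,
    Measure.restrict_eq_self_of_ae_mem (measure_eq_zero_iff_ae_notMem.1 h.measure_compl_nullSet
      |>.mono fun z hz => not_not.1 hz)]

/-- Converse of `holderDominated_Phi`: the equality case of Hölder is `g = D ^ s`, cut down to a set
`S` that avoids the singular part of `ν`. It gives `J ≤ C ^ (1 - θ) * J ^ θ`. -/
theorem Phi_le_of_holderDominated [IsProbabilityMeasure μ] [SigmaFinite ν] (hs : s < 0)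
    (h : HolderDominated (-s / (1 - s)) C μ ν) : Phi s μ ν ≤ C := by
  set θ := -s / (1 - s) with hθ
  have h0 : 0 < θ := theta_pos hs
  have h1 : θ < 1 := theta_lt_one hs
  have hθs : (θ⁻¹ - 1) = (-s)⁻¹ := by
    have : 1 - s ≠ 0 := by linarith
    have : s ≠ 0 := hs.ne
    rw [hθ]; field_simp; ring
  obtain ⟨S, hS, hμS, hνS⟩ := exists_measurableSet_restrict_eq_withDensity μ ν
  set D := ν.rnDeriv μ with hD
  have hDm : Measurable D := Measure.measurable_rnDeriv ν μ
  have hSae : ∀ᵐ z ∂μ, z ∈ S := (measure_eq_zero_iff_ae_notMem.1 hμS).mono fun z hz => not_not.1 hz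
  -- Truncation at `N` makes `J` finite, so that `J ^ θ` can be cancelled.
  have key : ∀ N : ℕ, ∫⁻ z, D z ^ s ⊓ N ∂μ ≤ C := fun N => by
    set m : Z → ℝ≥0∞ := fun z => D z ^ s ⊓ N with hm
    have hmm : Measurable m := (hDm.pow_const s).inf measurable_const
    set J := ∫⁻ z, m z ∂μ with hJ
    have hJtop : J ≠ ⊤ := by
      refine ne_top_of_le_ne_top (ENNReal.natCast_ne_top N) ?_
      calc J ≤ ∫⁻ _, N ∂μ := lintegral_mono fun z => inf_le_right
        _ = N := by simp
    have hA : ∫⁻ z, S.indicator m z ∂μ = J :=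
      lintegral_congr_ae (hSae.mono fun z hz => indicator_of_mem hz m)
    have hB : ∫⁻ z, S.indicator m z ^ θ⁻¹ ∂ν ≤ J := by
      calc ∫⁻ z, S.indicator m z ^ θ⁻¹ ∂ν = ∫⁻ z, S.indicator (fun z => m z ^ θ⁻¹) z ∂ν := by
            refine lintegral_congr fun z => ?_
            by_cases hz : z ∈ S
            · simp [hz]
            · simp [hz, h0]
        _ = ∫⁻ z, m z ^ θ⁻¹ ∂(μ.withDensity D) := by rw [lintegral_indicator hS, hνS]
        _ = ∫⁻ z, D z * m z ^ θ⁻¹ ∂μ :=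
            lintegral_withDensity_eq_lintegral_mul μ hDm (hmm.pow_const _)
        _ ≤ J := by
            refine lintegral_mono fun z => ?_
            have hmz : m z ≠ ⊤ := ne_top_of_le_ne_top (ENNReal.natCast_ne_top N) inf_le_right
            have h2 : m z ^ (θ⁻¹ - 1) ≤ (D z)⁻¹ := by
              rw [hθs]
              refine (ENNReal.rpow_le_rpow inf_le_left (by simpa using hs.le)).trans_eq ?_
              rw [← ENNReal.rpow_mul, ← ENNReal.rpow_neg_one]
              congr 1
              rw [inv_neg, mul_neg, mul_inv_cancel₀ hs.ne]
            calc D z * m z ^ θ⁻¹ = D z * (m z ^ (θ⁻¹ - 1) * m z) := by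
                  congr 1
                  conv_rhs => rw [← ENNReal.rpow_one (m z), ← ENNReal.rpow_mul, one_mul]
                  rw [← ENNReal.rpow_add_of_nonneg _ _ (by rw [hθs]; simpa using hs.le) zero_le_one]
                  simp
              _ ≤ D z * ((D z)⁻¹ * m z) := by gcongr
              _ = D z * (D z)⁻¹ * m z := (mul_assoc _ _ _).symm
              _ ≤ 1 * m z := by gcongr; exact ENNReal.mul_inv_le_one _
              _ = m z := one_mul _
    have hle : J ≤ C ^ (1 - θ) * J ^ θ := by
      calc J = _ := hA.symm
        _ ≤ _ := h _ (hmm.indicator hS)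
        _ ≤ _ := by gcongr
    rcases eq_or_ne J 0 with hJ0 | hJ0
    · simp [hJ0]
    have hsplit : J = J ^ (1 - θ) * J ^ θ := by
      rw [← ENNReal.rpow_add _ _ hJ0 hJtop]; simp
    rw [hsplit] at hle
    have hle' : J ^ (1 - θ) ≤ C ^ (1 - θ) := by
      have := hle.trans_eq (by rw [← hsplit])
      exact (ENNReal.mul_le_mul_iff_left (by simp [hJ0, hJtop])
        (ENNReal.rpow_ne_top_of_nonneg h0.le hJtop)).1 this
    exact (ENNReal.rpow_le_rpow_iff (sub_pos.2 h1)).1 hle'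
  calc Phi s μ ν = ∫⁻ z, ⨆ N : ℕ, D z ^ s ⊓ N ∂μ := by
        simp only [← inf_iSup_eq, ENNReal.iSup_natCast, inf_top_eq, Phi, hD]
    _ = ⨆ N : ℕ, ∫⁻ z, D z ^ s ⊓ N ∂μ :=
        lintegral_iSup (fun N => (hDm.pow_const s).inf measurable_const)
          fun a b hab z => inf_le_inf_left _ (by exact_mod_cast hab)
    _ ≤ C := iSup_le key

end Holder

/-! ### Tensorization along adaptive inputs -/

section Channels

variable {X Y : Type*} [MeasurableSpace X] [MeasurableSpace Y] {W Wbar : Kernel X Y}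
  [IsMarkovKernel W] [IsMarkovKernel Wbar] {θ : ℝ} {C : ℝ≥0∞}

theorem AdaptiveInput.holderDominated_law (h0 : 0 < θ) (h1 : θ < 1)
    (hW : ∀ x, HolderDominated θ C (W x) (Wbar x)) {n : ℕ} (p : AdaptiveInput X Y n) :
    HolderDominated θ (C ^ n) (p.law W) (p.law Wbar) := by
  induction p with
  | nil => simpa [AdaptiveInput.law] using HolderDominated.refl h0 h1 _
  | @snoc n p κ hκ ih =>
    have := p.isProbabilityMeasure_law W
    have := p.isProbabilityMeasure_law Wbar
    unfold AdaptiveInput.law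
    rw [pow_succ]
    refine (ih.compProd h0 h1.le fun z => ?_).map (measurable_snoc n)
    rw [Kernel.compProd_apply_eq_compProd_sectR, Kernel.compProd_apply_eq_compProd_sectR]
    rw [← one_mul C]
    exact (HolderDominated.refl h0 h1 (κ z)).compProd h0 h1.le fun x => hW x

/-- Passing through the dual inequality avoids any jointly measurable version of the densities
`dW̄_x/dW_x`. -/
theorem Phi_compProd_le {s : ℝ} (hs : s < 0) (hC : C ≠ ⊤) (hW : ∀ x, Phi s (W x) (Wbar x) ≤ C)
    (P : Measure X) [IsProbabilityMeasure P] : Phi s (P ⊗ₘ W) (P ⊗ₘ Wbar) ≤ C := by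
  refine Phi_le_of_holderDominated hs ?_
  rw [← one_mul C]
  exact (HolderDominated.refl (theta_pos hs) (theta_lt_one hs) P).compProd (theta_pos hs)
    (theta_lt_one hs).le fun x =>
    (holderDominated_Phi hs ((hW x).trans_lt hC.lt_top)).mono (theta_lt_one hs).le (hW x)

end Channels

/-! ### Exponents and the Han–Kobayashi bound -/

section Rates

theorem Phi_zero {Z : Type*} [MeasurableSpace Z] (μ ν : Measure Z) [IsProbabilityMeasure μ] :
    Phi 0 μ ν = 1 := by simp [Phi]

theorem phi_zero {Z : Type*} [MeasurableSpace Z] (μ ν : Measure Z) [IsProbabilityMeasure μ] :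
    phi 0 μ ν = 0 := by simp [phi, Phi_zero]

theorem log_ofReal_exp (c : ℝ) : ENNReal.log (ENNReal.ofReal (Real.exp c)) = c := by
  rw [ENNReal.log_ofReal_of_pos (Real.exp_pos c), Real.log_exp]

theorem le_neg_log_div_iff {n : ℕ} (hn : 0 < n) (x : ℝ≥0∞) (c : ℝ) :
    (c : EReal) ≤ -ENNReal.log x / (n : EReal) ↔ x ≤ ENNReal.ofReal (Real.exp (-(n * c))) := by
  have hn' : (0 : EReal) < n := by exact_mod_cast hn
  rw [EReal.le_div_iff_mul_le hn' (EReal.natCast_ne_top n), EReal.le_neg,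
    ← ENNReal.log_le_log_iff, log_ofReal_exp]
  rw [show -((c : EReal) * n) = ((-(n * c) : ℝ) : EReal) by push_cast; rw [mul_comm]]

theorem neg_log_div_le_iff {n : ℕ} (hn : 0 < n) (x : ℝ≥0∞) (c : ℝ) :
    -ENNReal.log x / (n : EReal) ≤ (c : EReal) ↔ ENNReal.ofReal (Real.exp (-(n * c))) ≤ x := by
  have hn' : (0 : EReal) < n := by exact_mod_cast hn
  rw [EReal.div_le_iff_le_mul hn' (EReal.natCast_ne_top n), EReal.neg_le,
    ← ENNReal.log_le_log_iff, log_ofReal_exp]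
  rw [show -((n : EReal) * c) = ((-(n * c) : ℝ) : EReal) by push_cast; rfl]

/-- The Han–Kobayashi bound is at most `V` iff `ψ` lies above the line through `(0, -V)` and
`(1, -r)`. -/
theorem hanKobayashi_le_iff (r V : ℝ) (ψ : ℝ → EReal) :
    hanKobayashi r ψ ≤ V ↔ ∀ s ≤ 0, (((V - r) * s - V : ℝ) : EReal) ≤ ψ s := by
  simp only [hanKobayashi, iSup_le_iff]
  refine forall₂_congr fun s hs => ?_
  have h1 : (0 : EReal) < ((1 - s : ℝ) : EReal) := by
    exact_mod_cast (by linarith : (0 : ℝ) < 1 - s)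
  rw [EReal.div_le_iff_le_mul h1 (EReal.coe_ne_top _), ← EReal.coe_mul]
  induction ψ s with
  | bot =>
    rw [EReal.coe_sub_bot]
    exact iff_of_false (by simp only [top_le_iff, EReal.coe_ne_top, not_false_eq_true])
      (by simp only [le_bot_iff, EReal.coe_ne_bot, not_false_eq_true])
  | top => simp
  | coe x =>
    norm_cast
    constructor <;> intro h <;> nlinarith

theorem hanKobayashi_anti {r : ℝ} {ψ ψ' : ℝ → EReal} (h : ∀ s ≤ 0, ψ s ≤ ψ' s) :
    hanKobayashi r ψ' ≤ hanKobayashi r ψ := by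
  refine EReal.le_of_forall_lt_iff_le.1 fun V hV => ?_
  rw [hanKobayashi_le_iff]
  exact fun s hs => ((hanKobayashi_le_iff r V ψ).1 hV.le s hs).trans (h s hs)

end Rates

/-! ### The lower bound for adaptive methods -/

section Channels

variable {X Y : Type*} [MeasurableSpace X] [MeasurableSpace Y] {W Wbar : Kernel X Y}
  [IsMarkovKernel W] [IsMarkovKernel Wbar]

theorem phiInput_le_phiSup {s : ℝ} (hs : s ≤ 0) (P : ProbabilityMeasure X) :
    phiInput s W Wbar P ≤ phiSup s W Wbar := by
  have := P.nonempty
  rcases hs.eq_or_lt with rfl | hs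
  · simp [phiInput, phiSup, phi_zero]
  rcases eq_or_ne (phiSup s W Wbar) ⊤ with h | h
  · simp [h]
  have hC : phiSup s W Wbar = ENNReal.log (EReal.exp (phiSup s W Wbar)) := by simp
  rw [hC, phiInput, phi, ENNReal.log_le_log_iff]
  refine Phi_compProd_le hs ?_ (fun x => ?_) _
  · rwa [ne_eq, ← ENNReal.log_eq_top_iff, EReal.log_exp]
  · rw [← ENNReal.log_le_log_iff, ← hC]
    exact le_iSup (fun x => phi s (W x) (Wbar x)) x

theorem Method.measurable_ofReal_one_sub {n : ℕ} (M : Method X Y n) :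
    Measurable fun z => ENNReal.ofReal (1 - M.test z) :=
  (measurable_const.sub M.measurable_test).ennreal_ofReal

theorem Method.ofReal_one_sub_le_one {n : ℕ} (M : Method X Y n) (z : Fin n → X × Y) :
    ENNReal.ofReal (1 - M.test z) ≤ 1 := by
  have := (M.test_mem z).1
  exact ENNReal.ofReal_le_one.2 (by linarith)

theorem Method.acceptNull_le_one {n : ℕ} (M : Method X Y n) : M.acceptNull W ≤ 1 := by
  have := M.input.isProbabilityMeasure_law W
  calc M.acceptNull W ≤ ∫⁻ _, 1 ∂(M.input.law W) := lintegral_mono M.ofReal_one_sub_le_one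
    _ = 1 := by simp

theorem Method.acceptNull_le {s : ℝ} (hs : s < 0) {φ : ℝ}
    (hφ : ∀ x, phi s (W x) (Wbar x) ≤ φ) {n : ℕ} (M : Method X Y n) :
    M.acceptNull W ≤ (ENNReal.ofReal (Real.exp φ) ^ n) ^ (1 - -s / (1 - s)) *
      M.acceptNull Wbar ^ (-s / (1 - s)) := by
  have hx : ∀ x, Phi s (W x) (Wbar x) ≤ ENNReal.ofReal (Real.exp φ) := fun x => by
    rw [← ENNReal.log_le_log_iff, log_ofReal_exp]; exact hφ x
  have h := AdaptiveInput.holderDominated_law (theta_pos hs) (theta_lt_one hs)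
    (fun x => (holderDominated_Phi hs ((hx x).trans_lt ENNReal.ofReal_lt_top)).mono
      (theta_lt_one hs).le (hx x)) M.input _ M.measurable_ofReal_one_sub
  refine h.trans (mul_le_mul_right (ENNReal.rpow_le_rpow (lintegral_mono fun z => ?_)
    (theta_pos hs).le) _)
  -- Since `0 ≤ 1 - f ≤ 1` and `1/θ ≥ 1`, the power only decreases the integrand.
  refine (ENNReal.rpow_le_rpow_of_exponent_ge (M.ofReal_one_sub_le_one z)
    ((one_le_inv₀ (theta_pos hs)).2 (theta_lt_one hs).le)).trans_eq (ENNReal.rpow_one _)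

theorem hanKobayashi_phiSup_le_rate [Nonempty X] {r : ℝ} (M : ∀ n, Method X Y n)
    (hM : (r : EReal) ≤ rate M Wbar) :
    hanKobayashi r (fun s => phiSup s W Wbar) ≤ rate M W := by
  refine iSup₂_le fun s hs => ?_
  rcases hs.eq_or_lt with rfl | hs
  · have : phiSup 0 W Wbar = 0 := by simp [phiSup, phi_zero]
    simp only [neg_zero, zero_mul, this, EReal.coe_zero, sub_zero, EReal.zero_div]
    refine le_liminf_of_le (by isBoundedDefault) ?_
    filter_upwards [eventually_gt_atTop 0] with n hn
    have := (le_neg_log_div_iff hn ((M n).acceptNull W) 0).2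
      (by simpa using (M n).acceptNull_le_one)
    simpa using this
  have h1s : (0 : ℝ) < 1 - s := by linarith
  have h1 : (0 : EReal) < ((1 - s : ℝ) : EReal) := by exact_mod_cast h1s
  simp only
  generalize hψ : phiSup s W Wbar = ψ
  induction ψ with
  | top =>
    rw [sub_eq_add_neg, EReal.neg_top, EReal.add_bot,
      EReal.bot_div_of_pos_ne_top h1 (EReal.coe_ne_top _)]
    exact bot_le
  | bot =>
    -- `Phi = 0` would force the density to be infinite almost everywhere, as `s < 0`.
    exfalso
    obtain ⟨x⟩ := ‹Nonempty X›
    have hb : phi s (W x) (Wbar x) = ⊥ :=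
      le_bot_iff.1 (hψ ▸ le_iSup (fun x => phi s (W x) (Wbar x)) x)
    rw [phi, ENNReal.log_eq_bot_iff, Phi,
      lintegral_eq_zero_iff ((Measure.measurable_rnDeriv _ _).pow_const s)] at hb
    have : ∀ᵐ _ ∂(W x), False := by
      filter_upwards [hb, (Wbar x).rnDeriv_lt_top (W x)] with z hz hz'
      simp only [Pi.zero_apply, ENNReal.rpow_eq_zero_iff] at hz
      rcases hz with hz | hz
      · linarith [hz.2]
      · exact hz'.ne hz.1
    exact this.exists.elim fun _ h => h
  | coe φ =>
    have hφ : ∀ x, phi s (W x) (Wbar x) ≤ φ := fun x =>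
      hψ ▸ le_iSup (fun x => phi s (W x) (Wbar x)) x
    -- A liminf at least `r` only bounds the terms eventually by each `r' < r`; continuity in `r'`
    -- recovers `r`.
    have key : ∀ r' : ℝ, r' < r → (((-s * r' - φ) / (1 - s) : ℝ) : EReal) ≤ rate M W := by
      intro r' hr'
      refine le_liminf_of_le (by isBoundedDefault) ?_
      have hev := eventually_lt_of_lt_liminf ((EReal.coe_lt_coe_iff.2 hr').trans_le hM)
      filter_upwards [hev, eventually_gt_atTop 0] with n hn hn0
      rw [le_neg_log_div_iff hn0]
      refine ((M n).acceptNull_le hs hφ).trans ?_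
      have h2 := (le_neg_log_div_iff hn0 _ r').1 hn.le
      calc _ ≤ (ENNReal.ofReal (Real.exp φ) ^ n) ^ (1 - -s / (1 - s)) *
            ENNReal.ofReal (Real.exp (-(n * r'))) ^ (-s / (1 - s)) :=
            mul_le_mul_right (ENNReal.rpow_le_rpow h2 (theta_pos hs).le) _
        _ = _ := by
            rw [← ENNReal.ofReal_pow (Real.exp_pos _).le, ← Real.exp_nat_mul,
              ENNReal.ofReal_rpow_of_pos (Real.exp_pos _),
              ENNReal.ofReal_rpow_of_pos (Real.exp_pos _), ← Real.exp_mul, ← Real.exp_mul,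
              ← ENNReal.ofReal_mul (Real.exp_pos _).le, ← Real.exp_add]
            congr 2
            field_simp
            ring
    rw [← EReal.coe_sub, ← EReal.coe_div]
    have hcont : Continuous fun r' : ℝ => (((-s * r' - φ) / (1 - s) : ℝ) : EReal) :=
      continuous_coe_real_ereal.comp (by fun_prop)
    exact le_of_tendsto ((hcont.tendsto r).mono_left nhdsWithin_le_nhds)
      (eventually_nhdsWithin_of_forall (s := Iio r) key)

end Channels

/-! ### The cumulant generating function of the log-likelihood ratio -/

section Cumulant

variable {Z : Type*} [MeasurableSpace Z] {μ ν : Measure Z} [IsProbabilityMeasure μ]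
  [IsProbabilityMeasure ν]

/-- The default values of `llr` where the density is `0` or `∞` are harmless: finiteness of `Phi
(-1)` excludes the first almost everywhere. -/
theorem ofReal_exp_mul_llr (hΦ : ∀ s ≤ 0, Phi s μ ν < ⊤) (s : ℝ) :
    (fun z => ENNReal.ofReal (Real.exp (s * llr ν μ z))) =ᵐ[μ] fun z => ν.rnDeriv μ z ^ s := by
  filter_upwards [rnDeriv_ne_zero_of_Phi neg_one_lt_zero (hΦ (-1) (by norm_num)),
    ν.rnDeriv_lt_top μ] with z hz hz'
  have hpos := ENNReal.toReal_pos hz hz'.ne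
  rw [mul_comm, Real.exp_mul, llr, Real.exp_log hpos, ← ENNReal.ofReal_rpow_of_pos hpos,
    ENNReal.ofReal_toReal hz'.ne]

theorem lintegral_exp_mul_llr (hΦ : ∀ s ≤ 0, Phi s μ ν < ⊤) (s : ℝ) :
    ∫⁻ z, ENNReal.ofReal (Real.exp (s * llr ν μ z)) ∂μ = Phi s μ ν :=
  lintegral_congr_ae (ofReal_exp_mul_llr hΦ s)

theorem integrable_exp_mul_llr (hΦ : ∀ s ≤ 0, Phi s μ ν < ⊤) {s : ℝ} (hs : Phi s μ ν < ⊤) :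
    Integrable (fun z => Real.exp (s * llr ν μ z)) μ := by
  refine ⟨((measurable_llr ν μ).const_mul s).exp.aestronglyMeasurable, ?_⟩
  rw [hasFiniteIntegral_iff_ofReal (ae_of_all _ fun z => (Real.exp_pos _).le),
    lintegral_exp_mul_llr hΦ]
  exact hs

theorem Phi_one_lt_top {Z : Type*} [MeasurableSpace Z] (μ ν : Measure Z) [IsFiniteMeasure ν] :
    Phi 1 μ ν < ⊤ := by
  simpa [Phi] using Measure.lintegral_rnDeriv_lt_top ν μ

/-- `Phi 1` is at most the mass of `ν`, so integrability extends by convexity from `s ≤ 0` to `s ≤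
1`. In particular `0` is an interior point, and the cumulant generating function is analytic there.
-/
theorem Iio_one_subset_interior_integrableExpSet (hΦ : ∀ s ≤ 0, Phi s μ ν < ⊤) :
    Iio 1 ⊆ interior (integrableExpSet (llr ν μ) μ) := by
  refine interior_maximal (fun s hs => ?_) isOpen_Iio
  rcases le_or_gt s 0 with h | h
  · exact integrable_exp_mul_llr hΦ (hΦ s h)
  · exact convex_integrableExpSet.ordConnected.out (integrable_exp_mul_llr hΦ (hΦ 0 le_rfl))
      (integrable_exp_mul_llr hΦ (Phi_one_lt_top μ ν)) ⟨h.le, le_of_lt hs⟩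

theorem phi_eq_cgf (hΦ : ∀ s ≤ 0, Phi s μ ν < ⊤) {s : ℝ} (hs : s ≤ 0) :
    phi s μ ν = (cgf (llr ν μ) μ s : ℝ) := by
  have hint := integrable_exp_mul_llr hΦ (hΦ s hs)
  have hmgf := ofReal_integral_eq_lintegral_ofReal hint (ae_of_all _ fun z => (Real.exp_pos _).le)
  rw [lintegral_exp_mul_llr hΦ] at hmgf
  rw [phi, ← hmgf]
  exact ENNReal.log_ofReal_of_pos (mgf_pos hint)

theorem convexOn_cgf_llr (hΦ : ∀ s ≤ 0, Phi s μ ν < ⊤) :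
    ConvexOn ℝ (Iio 1) (cgf (llr ν μ) μ) := by
  have hsub := Iio_one_subset_interior_integrableExpSet hΦ
  refine convexOn_of_deriv2_nonneg' (convex_Iio 1)
    (fun s hs => (analyticAt_cgf (hsub hs)).differentiableAt.differentiableWithinAt)
    (fun s hs => (analyticAt_cgf (hsub hs)).deriv.differentiableAt.differentiableWithinAt)
    fun s hs => ?_
  rw [← iteratedDeriv_eq_iterate, ← variance_tilted_mul (hsub hs)]
  exact variance_nonneg _ _

end Cumulant

/-- A differentiable function above the line through `(0, -V)` and `(1, -r)` has, for `V < V'`, a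
tangent line of slope less than `V' - r` whose value at `0` exceeds `-V'`. -/
theorem exists_tangent_of_line_le {φ : ℝ → ℝ} {r V V' : ℝ} (hd : ∀ s ≤ 0, DifferentiableAt ℝ φ s)
    (hc : ContinuousOn (deriv φ) (Iic 0)) (h0 : φ 0 = 0)
    (hV : ∀ s ≤ 0, (V - r) * s - V ≤ φ s) (hVV : V < V') :
    ∃ s ≤ 0, deriv φ s < V' - r ∧ -V' < φ s - s * deriv φ s := by
  have hV0 : 0 ≤ V := by have := hV 0 le_rfl; rw [h0] at this; linarith
  by_cases hd0 : deriv φ 0 < V' - r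
  · exact ⟨0, le_rfl, hd0, by rw [h0]; linarith⟩
  push Not at hd0
  -- If the slope is at least `V - r`, the tangent at `s ≤ 0` meets the axis at or above `-V`.
  have good : ∀ s ≤ 0, deriv φ s < V' - r → V - r ≤ deriv φ s →
      ∃ s ≤ 0, deriv φ s < V' - r ∧ -V' < φ s - s * deriv φ s := fun s hs h1 h2 =>
    ⟨s, hs, h1, by nlinarith [hV s hs, mul_le_mul_of_nonneg_left h2 (neg_nonneg.2 hs)]⟩
  obtain ⟨s₁, hs₁, hds₁⟩ : ∃ s ≤ 0, deriv φ s < V' - r := by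
    by_contra! hcon
    -- Chosen so that `(V' - r) * s = (V - r) * s - (V + 1)`: with slopes at least `V' - r` on all
    -- of `[s, 0]`, `φ s` would fall below the line.
    set s := -((V + 1) / (V' - V)) with hs
    have hpos : 0 < (V + 1) / (V' - V) := div_pos (by linarith) (by linarith)
    have hneg : s < 0 := by linarith
    obtain ⟨ξ, hξ, hξe⟩ := exists_deriv_eq_slope φ hneg
      (fun x hx => (hd x hx.2).continuousAt.continuousWithinAt)
      fun x hx => (hd x hx.2.le).differentiableWithinAt
    have h1 := hcon ξ hξ.2.le
    rw [hξe, le_div_iff₀ (by linarith), h0] at h1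
    have h2 := hV s hneg.le
    have h3 : (V' - V) * s = -(V + 1) := by
      rw [hs]; field_simp [(by linarith : V' - V ≠ 0)]
    nlinarith
  rcases le_or_gt (V - r) (deriv φ s₁) with h | h
  · exact good s₁ hs₁ hds₁ h
  obtain ⟨s₂, hs₂, he⟩ := intermediate_value_Icc hs₁ (hc.mono fun x hx => hx.2)
    (show V - r ∈ Icc (deriv φ s₁) (deriv φ 0) from ⟨h.le, by linarith⟩)
  exact good s₂ hs₂.2 (by rw [he]; linarith) he.ge

/-! ### Densities and the law of large numbers on finite powers -/

section Product

variable {Z : Type*} [MeasurableSpace Z]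

theorem pi_eq_withDensity_prod (μ ν : Measure Z) [IsProbabilityMeasure μ] [SigmaFinite ν]
    {f : Z → ℝ≥0∞} (hf : Measurable f) (h : ν = μ.withDensity f) (n : ℕ) :
    Measure.pi (fun _ : Fin n => ν) =
      (Measure.pi fun _ : Fin n => μ).withDensity fun z => ∏ i, f (z i) := by
  refine Measure.pi_eq fun t ht => ?_
  rw [withDensity_apply _ (MeasurableSet.univ_pi ht),
    ← lintegral_indicator (MeasurableSet.univ_pi ht)]
  have hind : ∀ z : Fin n → Z, (univ.pi t).indicator (fun z => ∏ i, f (z i)) z =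
      ∏ i, (t i).indicator f (z i) := fun z => by
    by_cases hz : z ∈ univ.pi t
    · rw [indicator_of_mem hz]
      exact Finset.prod_congr rfl fun i _ => (indicator_of_mem (hz i (mem_univ i)) f).symm
    · rw [indicator_of_notMem hz]
      simp only [Set.mem_pi, mem_univ, true_imp_iff, not_forall] at hz
      obtain ⟨i, hi⟩ := hz
      exact (Finset.prod_eq_zero (Finset.mem_univ i) (indicator_of_notMem hi f)).symm
  simp only [hind]
  have hm : ∀ i, Measurable ((t i).indicator f) := fun i => hf.indicator (ht i)
  have hprod := lintegral_prod_eq_prod_lintegral_of_indepFun Finset.univ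
    (fun i (z : Fin n → Z) => (t i).indicator f (z i))
    (iIndepFun_pi (μ := fun _ : Fin n => μ) fun i => (hm i).aemeasurable)
    fun i => (hm i).comp (measurable_pi_apply i)
  rw [hprod]
  refine Finset.prod_congr rfl fun i _ => ?_
  rw [(measurePreserving_eval (fun _ : Fin n => μ) i).lintegral_comp (hm i),
    lintegral_indicator (ht i), h, withDensity_apply _ (ht i)]

theorem pi_apply_eq_setLIntegral_exp_sum (μ ν : Measure Z) [IsProbabilityMeasure μ] [SigmaFinite ν]
    {f : Z → ℝ} (hf : Measurable f) (h : ν = μ.withDensity fun z => ENNReal.ofReal (Real.exp (f z)))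
    {n : ℕ} {A : Set (Fin n → Z)} (hA : MeasurableSet A) :
    Measure.pi (fun _ : Fin n => ν) A =
      ∫⁻ z in A, ENNReal.ofReal (Real.exp (∑ i, f (z i))) ∂(Measure.pi fun _ : Fin n => μ) := by
  rw [pi_eq_withDensity_prod μ ν hf.exp.ennreal_ofReal h n, withDensity_apply _ hA]
  simp only [Real.exp_sum, ENNReal.ofReal_prod_of_nonneg fun _ _ => (Real.exp_pos _).le]

/-- The weak law of large numbers on finite powers of a probability space. -/
theorem eventually_half_le_pi (μ : Measure Z) [IsProbabilityMeasure μ] {f : Z → ℝ}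
    (hf : MemLp f 2 μ) {S : Set Z} (hS : μ Sᶜ = 0) {δ : ℝ} (hδ : 0 < δ) :
    ∀ᶠ n : ℕ in atTop, 2⁻¹ ≤ Measure.pi (fun _ : Fin n => μ)
      {z | (∀ i, z i ∈ S) ∧ |∑ i, f (z i) - n * ∫ x, f x ∂μ| < n * δ} := by
  have hlim : Tendsto (fun n : ℕ => ENNReal.ofReal (Var[f; μ] / δ ^ 2 / n)) atTop (nhds 0) := by
    rw [← ENNReal.ofReal_zero]
    exact ENNReal.tendsto_ofReal (tendsto_const_div_atTop_nhds_zero_nat _)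
  filter_upwards [hlim.eventually_le_const (show (0 : ℝ≥0∞) < 2⁻¹ by simp), eventually_gt_atTop 0]
    with n hn hn0
  have hn0' : (0 : ℝ) < n := by exact_mod_cast hn0
  set π := Measure.pi fun _ : Fin n => μ with hπ
  have hfi : ∀ i : Fin n, MemLp (fun z : Fin n → Z => f (z i)) 2 π := fun i =>
    hf.comp_measurePreserving (measurePreserving_eval (fun _ : Fin n => μ) i)
  have hsum : MemLp (∑ i, fun z : Fin n → Z => f (z i)) 2 π := memLp_finsetSum' _ fun i _ => hfi i
  have hmean : ∫ z, (∑ i, fun z : Fin n → Z => f (z i)) z ∂π = n * ∫ x, f x ∂μ := by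
    simp only [Finset.sum_apply]
    rw [integral_finsetSum _ fun i _ => (hfi i).integrable (by norm_num)]
    simp [hπ, integral_comp_eval (μ := fun _ : Fin n => μ) hf.aestronglyMeasurable]
  have hcheb := meas_ge_le_variance_div_sq hsum (mul_pos hn0' hδ)
  rw [hmean, variance_sum_pi (μ := fun _ : Fin n => μ) (X := fun _ => f) fun _ => hf] at hcheb
  have hbound : π {z | n * δ ≤ |(∑ i, fun z : Fin n → Z => f (z i)) z - n * ∫ x, f x ∂μ|} ≤ 2⁻¹ := by
    refine hcheb.trans (le_trans (le_of_eq ?_) hn)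
    congr 1
    simp only [Finset.sum_const, Finset.card_univ, Fintype.card_fin, nsmul_eq_mul]
    field_simp
  have hSae : ∀ᵐ z ∂π, ∀ i, z i ∈ S := ae_all_iff.2 fun i =>
    (measurePreserving_eval (fun _ : Fin n => μ) i).quasiMeasurePreserving.ae
      ((measure_eq_zero_iff_ae_notMem.1 hS).mono fun z hz => not_not.1 hz)
  set A := {z : Fin n → Z | (∀ i, z i ∈ S) ∧ |∑ i, f (z i) - n * ∫ x, f x ∂μ| < n * δ}
  have hAc : π Aᶜ ≤ 2⁻¹ := by
    refine (measure_mono_ae ?_).trans hbound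
    filter_upwards [hSae] with z hz hzA
    by_contra hlt
    refine hzA ⟨hz, ?_⟩
    have hlt' : z ∉ {z | n * δ ≤ |(∑ i, fun z : Fin n → Z => f (z i)) z - n * ∫ x, f x ∂μ|} := hlt
    simpa using hlt'
  have h1 : (1 : ℝ≥0∞) ≤ π A + 2⁻¹ := by
    calc (1 : ℝ≥0∞) = π univ := by simp [hπ]
      _ = π (A ∪ Aᶜ) := by rw [union_compl_self]
      _ ≤ π A + π Aᶜ := measure_union_le _ _
      _ ≤ _ := by gcongr
  rw [← ENNReal.inv_two_add_inv_two] at h1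
  exact (ENNReal.add_le_add_iff_right (by simp)).1 h1

end Product

/-! ### Typical sets of the tilted measure -/

section TypicalSets

variable {Z : Type*} [MeasurableSpace Z] {μ ν : Measure Z} [IsProbabilityMeasure μ]
  [IsProbabilityMeasure ν]

/-- Undoing the tilt: for `f = llr ν μ`, `a = 0` recovers `μ` and `a = 1` the absolutely continuous
part of `ν`. -/
theorem withDensity_tilted_eq {f : Z → ℝ} (hf : Measurable f) {s : ℝ}
    (hint : Integrable (fun z => Real.exp (s * f z)) μ) (a : ℝ) :
    (μ.tilted fun z => s * f z).withDensity
        (fun z => ENNReal.ofReal (Real.exp ((a - s) * f z + cgf f μ s))) =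
      μ.withDensity fun z => ENNReal.ofReal (Real.exp (a * f z)) := by
  have hpos : 0 < mgf f μ s := mgf_pos hint
  rw [Measure.tilted, ← withDensity_mul _ (by fun_prop) (by fun_prop)]
  congr 1
  ext z
  change ENNReal.ofReal (Real.exp (s * f z) / mgf f μ s) * _ = _
  rw [← ENNReal.ofReal_mul (div_nonneg (Real.exp_pos _).le hpos.le), Real.exp_add,
    cgf, Real.exp_log hpos]
  congr 1
  field_simp
  rw [← Real.exp_add]
  congr 1
  ring

/-- Sets that are typical for the tilted measure: they bound the exponents of both hypotheses by
the values at `0` and `1` of the tangent line of the cumulant generating function. -/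
theorem exists_typical_sets (hΦ : ∀ s ≤ 0, Phi s μ ν < ⊤) {s : ℝ} (hs : s ≤ 0) {δ : ℝ}
    (hδ : 0 < δ) : ∃ A : ∀ n : ℕ, Set (Fin n → Z), (∀ n, MeasurableSet (A n)) ∧
      (∀ n : ℕ, Measure.pi (fun _ : Fin n => ν) (A n) ≤ ENNReal.ofReal (Real.exp
        (n * ((1 - s) * (deriv (cgf (llr ν μ) μ) s + δ) + cgf (llr ν μ) μ s)))) ∧
      ∀ᶠ n : ℕ in atTop, ENNReal.ofReal (Real.exp
        (n * (-s * (deriv (cgf (llr ν μ) μ) s - δ) + cgf (llr ν μ) μ s))) * 2⁻¹ ≤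
          Measure.pi (fun _ : Fin n => μ) (A n) := by
  set f := llr ν μ with hf
  have hfm : Measurable f := measurable_llr ν μ
  set m := deriv (cgf f μ) s with hm
  set κ := cgf f μ s with hκ
  have hint : Integrable (fun z => Real.exp (s * f z)) μ := integrable_exp_mul_llr hΦ (hΦ s hs)
  have hmem : s ∈ interior (integrableExpSet f μ) :=
    Iio_one_subset_interior_integrableExpSet hΦ (show s < 1 by linarith)
  set T := μ.tilted fun z => s * f z with hT
  have hTp : IsProbabilityMeasure T := isProbabilityMeasure_tilted hint
  obtain ⟨S, hS, hμS, hνS⟩ := exists_measurableSet_restrict_eq_withDensity μ ν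
  have hμT : μ = T.withDensity fun z => ENNReal.ofReal (Real.exp ((0 - s) * f z + κ)) := by
    rw [hT, withDensity_tilted_eq hfm hint]; simp
  have hνT : ν.restrict S = T.withDensity fun z =>
      ENNReal.ofReal (Real.exp ((1 - s) * f z + κ)) := by
    rw [hT, withDensity_tilted_eq hfm hint, hνS]
    refine withDensity_congr_ae ?_
    filter_upwards [ofReal_exp_mul_llr hΦ 1] with z hz
    rw [hz, ENNReal.rpow_one]
  have hmean : ∫ z, f z ∂T = m := integral_tilted_mul_self hmem
  have hL2 : MemLp f 2 T := memLp_tilted_mul hmem 2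
  have hTS : T Sᶜ = 0 := tilted_absolutelyContinuous μ _ hμS
  have hsum : ∀ n : ℕ, Measurable fun z : Fin n → Z => ∑ i, f (z i) := fun n =>
    Finset.measurable_sum _ fun i _ => hfm.comp (measurable_pi_apply i)
  set A : ∀ n : ℕ, Set (Fin n → Z) := fun n =>
    {z | (∀ i, z i ∈ S) ∧ |∑ i, f (z i) - n * m| < n * δ} with hA
  have hAm : ∀ n, MeasurableSet (A n) := fun n => by
    have hAeq : A n = univ.pi (fun _ => S) ∩ {z | |∑ i, f (z i) - n * m| < n * δ} := by
      ext z; simp [hA]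
    rw [hAeq]
    exact (MeasurableSet.univ_pi fun _ => hS).inter
      (measurableSet_lt (((hsum n).sub measurable_const).abs) measurable_const)
  have hexp : ∀ (a : ℝ) (n : ℕ) (z : Fin n → Z),
      ∑ i, (a * f (z i) + κ) = a * ∑ i, f (z i) + n * κ := fun a n z => by
    simp [Finset.sum_add_distrib, Finset.mul_sum]
  refine ⟨A, hAm, fun n => ?_, ?_⟩
  -- `A n` lies in `S ^ n`, where the singular part of `ν` is invisible.
  · have hAS : Measure.pi (fun _ : Fin n => ν) (A n) =
        Measure.pi (fun _ : Fin n => ν.restrict S) (A n) := by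
      rw [← Measure.restrict_pi_pi, Measure.restrict_eq_self _ fun z hz i _ => hz.1 i]
    rw [hAS, pi_apply_eq_setLIntegral_exp_sum T (ν.restrict S)
      (f := fun z => (1 - s) * f z + κ) ((hfm.const_mul _).add measurable_const) hνT (hAm n)]
    calc _ ≤ ∫⁻ _ in A n, ENNReal.ofReal (Real.exp (n * ((1 - s) * (m + δ) + κ)))
          ∂(Measure.pi fun _ : Fin n => T) := by
          refine setLIntegral_mono' (hAm n) fun z hz => ?_
          rw [hexp]
          have := (abs_lt.1 hz.2).2
          refine ENNReal.ofReal_le_ofReal (Real.exp_le_exp.2 ?_)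
          nlinarith [mul_le_mul_of_nonneg_left this.le (by linarith : 0 ≤ 1 - s)]
      _ ≤ _ := by
          rw [setLIntegral_const]
          exact mul_le_of_le_one_right' prob_le_one
  · filter_upwards [eventually_half_le_pi T hL2 hTS hδ] with n hn
    rw [hmean] at hn
    rw [pi_apply_eq_setLIntegral_exp_sum T μ (f := fun z => (0 - s) * f z + κ)
      ((hfm.const_mul _).add measurable_const) hμT (hAm n)]
    calc _ ≤ ∫⁻ _ in A n, ENNReal.ofReal (Real.exp (n * (-s * (m - δ) + κ)))
          ∂(Measure.pi fun _ : Fin n => T) := by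
          rw [setLIntegral_const]
          gcongr
      _ ≤ _ := by
          refine setLIntegral_mono' (hAm n) fun z hz => ?_
          rw [hexp]
          have := (abs_lt.1 hz.2).1
          refine ENNReal.ofReal_le_ofReal (Real.exp_le_exp.2 ?_)
          nlinarith [mul_le_mul_of_nonneg_left this.le (by linarith : 0 ≤ -s)]

end TypicalSets

/-! ### Achievability with independent inputs -/

section Channels

variable {X Y : Type*} [MeasurableSpace X] [MeasurableSpace Y]

theorem AdaptiveInput.law_iid (W : Kernel X Y) [IsMarkovKernel W] (P : ProbabilityMeasure X)
    (n : ℕ) : (AdaptiveInput.iid Y P n).law W =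
      Measure.pi fun _ : Fin n => (P : Measure X) ⊗ₘ W := by
  induction n with
  | zero =>
    rw [AdaptiveInput.iid, AdaptiveInput.law, Measure.pi_of_empty _ Fin.elim0]
  | succ n ih =>
    rw [AdaptiveInput.iid, AdaptiveInput.law, ih]
    have hker : (Kernel.const (Fin n → X × Y) (P : Measure X)) ⊗ₖ
        Kernel.prodMkLeft (Fin n → X × Y) W = Kernel.const _ ((P : Measure X) ⊗ₘ W) := by
      ext z : 1
      rw [Kernel.compProd_apply_eq_compProd_sectR]
      rfl
    rw [hker, Measure.compProd_const]
    -- Appending is insertion at the last index, up to the order of the two factors.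
    have hmp := (measurePreserving_piFinSuccAbove
      (fun _ : Fin (n + 1) => (P : Measure X) ⊗ₘ W) (Fin.last n)).symm
    rw [← hmp.map_eq, ← Measure.prod_swap, Measure.map_map (measurable_snoc n) measurable_swap]
    congr 1
    ext z : 1
    exact (Fin.insertNth_last' z.1 z.2).symm

/-- The method with independent inputs of law `P` that accepts the null hypothesis with
probability `exp (-n c)` on the set `A`. -/
noncomputable def scaledIndicatorMethod (P : ProbabilityMeasure X) {n : ℕ} {A : Set (Fin n → X × Y)}
    (hA : MeasurableSet A) {c : ℝ} (hc : 0 ≤ c) : Method X Y n where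
  input := AdaptiveInput.iid Y P n
  test := fun z => 1 - A.indicator (fun _ => Real.exp (-(n * c))) z
  measurable_test := measurable_const.sub (measurable_const.indicator hA)
  test_mem := fun z => by
    have h1 : Real.exp (-(n * c)) ≤ 1 := Real.exp_le_one_iff.2 (by simpa using by positivity)
    by_cases hz : z ∈ A
    · simp [hz, h1, (Real.exp_pos _).le]
    · simp [hz]

theorem acceptNull_scaledIndicatorMethod (W : Kernel X Y) [IsMarkovKernel W]
    (P : ProbabilityMeasure X) {n : ℕ} {A : Set (Fin n → X × Y)} (hA : MeasurableSet A) {c : ℝ}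
    (hc : 0 ≤ c) : (scaledIndicatorMethod P hA hc).acceptNull W =
      ENNReal.ofReal (Real.exp (-(n * c))) * Measure.pi (fun _ => (P : Measure X) ⊗ₘ W) A := by
  rw [← AdaptiveInput.law_iid, ← lintegral_indicator_const hA]
  refine lintegral_congr fun z => ?_
  by_cases hz : z ∈ A <;> simp [scaledIndicatorMethod, hz]

theorem nonAdaptiveExponent_le {W Wbar : Kernel X Y} [IsMarkovKernel W] [IsMarkovKernel Wbar]
    (P : ProbabilityMeasure X)
    (hΦ : ∀ s ≤ 0, Phi s ((P : Measure X) ⊗ₘ W) ((P : Measure X) ⊗ₘ Wbar) < ⊤) (r : ℝ) :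
    nonAdaptiveExponent r W Wbar P ≤ hanKobayashi r fun s => phiInput s W Wbar P := by
  refine EReal.le_of_forall_lt_iff_le.1 fun V' hV' => ?_
  obtain ⟨V, hV, hVV⟩ := EReal.lt_iff_exists_real_btwn.1 hV'
  rw [EReal.coe_lt_coe_iff] at hVV
  set μ := (P : Measure X) ⊗ₘ W with hμ
  set ν := (P : Measure X) ⊗ₘ Wbar with hν
  have hline : ∀ s ≤ 0, (V - r) * s - V ≤ cgf (llr ν μ) μ s := fun s hs => by
    have := (hanKobayashi_le_iff r V _).1 hV.le s hs
    rwa [phiInput, phi_eq_cgf hΦ hs, EReal.coe_le_coe_iff] at this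
  have hana : ∀ s ≤ 0, AnalyticAt ℝ (cgf (llr ν μ) μ) s := fun s hs =>
    analyticAt_cgf (Iio_one_subset_interior_integrableExpSet hΦ (show s < 1 by linarith))
  obtain ⟨s, hs, h1, h2⟩ := exists_tangent_of_line_le
    (fun s hs => (hana s hs).differentiableAt)
    (fun s hs => (hana s hs).deriv.continuousAt.continuousWithinAt) cgf_zero hline hVV
  set m := deriv (cgf (llr ν μ) μ) s with hm
  set κ := cgf (llr ν μ) μ s with hκ
  -- `η` is a common slack for the value of the tangent at `0` and for its slope; `δ` is set so that
  -- the typicality error `(1 - s) * δ` uses `η / 2`.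
  obtain ⟨η, hη, hη1, hη2⟩ : ∃ η > 0, η ≤ κ - s * m + V' ∧ 2 * η ≤ V' - r - m := by
    refine ⟨min (κ - s * m + V') ((V' - r - m) / 2), lt_min (by linarith) (by linarith),
      min_le_left _ _, ?_⟩
    linarith [min_le_right (κ - s * m + V') ((V' - r - m) / 2)]
  set δ := η / (2 * (1 - s)) with hδ
  have hs1 : 0 < 1 - s := by linarith
  have hδ0 : 0 < δ := by positivity
  have hδ1 : (1 - s) * δ = η / 2 := by rw [hδ]; field_simp
  obtain ⟨A, hAm, hAν, hAμ⟩ := exists_typical_sets hΦ hs hδ0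
  -- `μ` gives `A n` about `exp (n (κ - s m))`; damping by `exp (-n c)` brings its exponent to `V' -
  -- η`. For `ν` the exponent becomes about `V' - η - m`, which exceeds `r` because `m < V' - r`.
  set c := κ - s * m + V' - η with hc
  have hc0 : 0 ≤ c := by linarith
  set M : ∀ n, Method X Y n := fun n => scaledIndicatorMethod P (hAm n) hc0 with hM
  have hrate : (r : EReal) ≤ rate M Wbar := by
    refine le_liminf_of_le (by isBoundedDefault) ?_
    filter_upwards [eventually_gt_atTop 0] with n hn
    rw [le_neg_log_div_iff hn, hM, acceptNull_scaledIndicatorMethod]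
    refine (mul_le_mul_right (hAν n) _).trans ?_
    rw [← ENNReal.ofReal_mul (Real.exp_pos _).le, ← Real.exp_add]
    refine ENNReal.ofReal_le_ofReal (Real.exp_le_exp.2 ?_)
    have : -c + ((1 - s) * (m + δ) + κ) ≤ -r := by rw [hc]; linarith
    nlinarith [mul_le_mul_of_nonneg_left this (Nat.cast_nonneg (α := ℝ) n)]
  refine (iInf₂_le_of_le M (fun n => rfl) (iInf_le _ hrate)).trans ?_
  refine liminf_le_of_frequently_le' (Eventually.frequently ?_)
  -- The factor `1/2` from the law of large numbers is paid for by another `η / 2`.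
  have hhalf : ∀ᶠ n : ℕ in atTop, Real.exp (-(n * (η / 2))) ≤ 2⁻¹ := by
    have : Tendsto (fun n : ℕ => Real.exp (-(n * (η / 2)))) atTop (nhds 0) :=
      Real.tendsto_exp_neg_atTop_nhds_zero.comp
        (tendsto_natCast_atTop_atTop.atTop_mul_const (by linarith))
    exact this.eventually_le_const (by norm_num)
  filter_upwards [eventually_gt_atTop 0, hAμ, hhalf] with n hn hnA hnh
  rw [neg_log_div_le_iff hn, hM, acceptNull_scaledIndicatorMethod]
  refine le_trans ?_ (mul_le_mul_right hnA _)
  have h2inv : (2⁻¹ : ℝ≥0∞) = ENNReal.ofReal 2⁻¹ := by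
    rw [ENNReal.ofReal_inv_of_pos two_pos]; simp
  rw [h2inv, ← ENNReal.ofReal_mul (Real.exp_pos _).le, ← ENNReal.ofReal_mul (Real.exp_pos _).le]
  refine ENNReal.ofReal_le_ofReal ?_
  refine le_trans ?_ (mul_le_mul_of_nonneg_left
    (mul_le_mul_of_nonneg_left hnh (Real.exp_pos _).le) (Real.exp_pos _).le)
  rw [← Real.exp_add, ← Real.exp_add]
  refine Real.exp_le_exp.2 ?_
  have : -V' ≤ -c + (-s * (m - δ) + κ - η / 2) := by rw [hc]; nlinarith
  nlinarith [mul_le_mul_of_nonneg_left this (Nat.cast_nonneg (α := ℝ) n)]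

end Channels

/-! ### Reduction of the minimax problem to two inputs -/

section Minimax

theorem _root_.ConvexOn.add_deriv_mul_sub_le {S : Set ℝ} {f : ℝ → ℝ} (hf : ConvexOn ℝ S f) {x y : ℝ}
    (hx : x ∈ S) (hy : y ∈ S) (hd : DifferentiableAt ℝ f x) :
    f x + deriv f x * (y - x) ≤ f y := by
  rcases lt_trichotomy x y with h | rfl | h
  · have := hf.deriv_le_slope hx hy h hd
    rw [slope_def_field, le_div_iff₀ (sub_pos.2 h)] at this
    linarith
  · simp
  · have := hf.slope_le_deriv hy hx h hd
    rw [slope_def_field, div_le_iff₀ (sub_pos.2 h)] at this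
    linarith

/-- Closed intervals, one of them compact, that intersect pairwise have a common point. -/
theorem nonempty_iInter_of_pairwise {ι : Type*} [Nonempty ι] {K : ι → Set ℝ}
    (hclosed : ∀ i, IsClosed (K i)) (hconv : ∀ i, (K i).OrdConnected)
    (hbdd : ∀ i, BddAbove (K i)) {i₀ : ι} (hbelow : BddBelow (K i₀))
    (hpair : ∀ i j, (K i ∩ K j).Nonempty) : ∃ c, ∀ i, c ∈ K i := by
  have hne : ∀ i, (K i).Nonempty := fun i => (hpair i i).left
  obtain ⟨b, hb⟩ := hbelow
  have hrange : BddBelow (range fun i => sSup (K i)) := by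
    refine ⟨b, ?_⟩
    rintro _ ⟨i, rfl⟩
    obtain ⟨p, hp, hp'⟩ := hpair i i₀
    exact (hb hp').trans (le_csSup (hbdd i) hp)
  -- The smallest right endpoint is a common point: were it left of some `K j`, an interval ending
  -- before `K j` begins would be disjoint from it. The interval `K i₀` keeps the infimum finite.
  refine ⟨⨅ i, sSup (K i), fun j => ?_⟩
  obtain ⟨p, hp, hpc⟩ : ∃ p ∈ K j, p ≤ ⨅ i, sSup (K i) := by
    by_contra! hcon
    have hbj : BddBelow (K j) := ⟨_, fun p hp => (hcon p hp).le⟩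
    obtain ⟨i, hi⟩ := exists_lt_of_ciInf_lt (hcon _ ((hclosed j).csInf_mem (hne j) hbj))
    obtain ⟨q, hqi, hqj⟩ := hpair i j
    exact absurd ((csInf_le hbj hqj).trans (le_csSup (hbdd i) hqi)) (not_le.2 hi)
  exact (hconv j).out hp ((hclosed j).csSup_mem (hne j) (hbdd j)) ⟨hpc, ciInf_le hrange j⟩

variable {ι : Type*} {φ : ι → ℝ → ℝ} {r V V' : ℝ}

/-- Otherwise the sublevel intervals meet pairwise, hence have a common point `c ≤ 0`, at which all
`φ i` are below the line for `V'`. That line is strictly below the one for `V` when `s < 1`,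
contradicting `hV` at `c`. -/
theorem exists_disjoint_sublevel [Nonempty ι] (hconv : ∀ i, ConvexOn ℝ (Iio 1) (φ i))
    (hcont : ∀ i, ContinuousOn (φ i) (Iic 0)) (h0 : ∀ i, φ i 0 = 0)
    (hV : ∀ s ≤ 0, ∀ a < (V - r) * s - V, ∃ i, a < φ i s) (hVV : V < V') :
    ∃ i j, ∀ s ≤ 0, (V' - r) * s - V' < φ i s ∨ (V' - r) * s - V' < φ j s := by
  have hV0 : 0 ≤ V := by
    by_contra! h
    obtain ⟨i, hi⟩ := hV 0 le_rfl 0 (by linarith)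
    exact (h0 i ▸ hi).false
  set K : ι → Set ℝ := fun i => {s ∈ Iic (0 : ℝ) | φ i s ≤ (V' - r) * s - V'} with hK
  by_contra! hcon
  have hpair : ∀ i j, (K i ∩ K j).Nonempty := fun i j => by
    obtain ⟨s, hs, hi, hj⟩ := hcon i j
    exact ⟨s, ⟨hs, hi⟩, ⟨hs, hj⟩⟩
  have hclosed : ∀ i, IsClosed (K i) := fun i =>
    isClosed_Iic.isClosed_le (hcont i) (by fun_prop)
  have hord : ∀ i, (K i).OrdConnected := fun i => by
    have hc : ConvexOn ℝ (Iic 0) fun s => φ i s - ((V' - r) * s - V') := by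
      refine ((hconv i).subset (fun s hs => lt_of_le_of_lt hs one_pos) (convex_Iic 0)).sub ?_
      refine ⟨convex_Iic 0, fun x _ y _ a b _ _ hab => le_of_eq ?_⟩
      simp only [smul_eq_mul]
      linear_combination -V' * hab
    have := (hc.convex_le 0).ordConnected
    convert! this using 3 with s
    exact ⟨fun h => ⟨h.1, sub_nonpos.2 h.2⟩, fun h => ⟨h.1, sub_nonpos.1 h.2⟩⟩
  obtain ⟨i₀, hi₀⟩ : ∃ i, BddBelow (K i) := by
    -- If `φ i` is below the line for `V'` at `p < s`, then convexity and `φ i 0 = 0` give `φ i s ≤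
    -- (V' - r) * s`. The point `s` is chosen so that this fails for some `i`.
    by_contra! hunb
    set s := -((V + 1) / (V' - V)) with hs
    have hpos : 0 < (V + 1) / (V' - V) := div_pos (by linarith) (by linarith)
    have hneg : s < 0 := by linarith
    have h3 : (V' - V) * s = -(V + 1) := by
      rw [hs]; field_simp [(by linarith : V' - V ≠ 0)]
    obtain ⟨i, hi⟩ := hV s hneg.le ((V' - r) * s) (by linarith)
    obtain ⟨p, hp, hps⟩ := not_bddBelow_iff.1 (hunb i) s
    have hp0 : p < 0 := hps.trans hneg
    have hl0 : 0 ≤ s / p := div_nonneg_of_nonpos hneg.le hp0.le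
    have hl1 : s / p ≤ 1 := (div_le_one_of_neg hp0).2 hps.le
    have hc := (hconv i).2 (show p ∈ Iio (1 : ℝ) from hp0.trans one_pos)
      (mem_Iio.2 (zero_lt_one' ℝ)) hl0 (sub_nonneg.2 hl1) (by ring)
    simp only [smul_eq_mul, mul_zero, add_zero, h0, div_mul_cancel₀ s hp0.ne] at hc
    have h4 := mul_le_mul_of_nonneg_left hp.2 hl0
    have h5 : s / p * ((V' - r) * p - V') = (V' - r) * s - s / p * V' := by
      linear_combination (V' - r) * div_mul_cancel₀ s hp0.ne
    have h6 : 0 ≤ s / p * V' := mul_nonneg hl0 (by linarith)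
    linarith
  obtain ⟨c, hc⟩ := nonempty_iInter_of_pairwise hclosed hord (fun i => ⟨0, fun s hs => hs.1⟩)
    hi₀ hpair
  have hc0 : c ≤ 0 := (hc i₀).1
  obtain ⟨j, hj⟩ := hV c hc0 ((V' - r) * c - V') (by nlinarith)
  exact absurd (hc j).2 (not_le.2 hj)

/-- The graphs of `f` and `g` cross at some `c` between `p` and `q`, above the line. There the
tangent of `f` is steeper than the line and that of `g` flatter, so some mixture of the tangents is
parallel to the line and above it; by convexity it bounds the mixture of `f` and `g` from below. -/
theorem exists_convexCombination_of_lt {f g : ℝ → ℝ} (hf : ConvexOn ℝ (Iio 1) f)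
    (hg : ConvexOn ℝ (Iio 1) g) (hfd : ∀ s ≤ 0, DifferentiableAt ℝ f s)
    (hgd : ∀ s ≤ 0, DifferentiableAt ℝ g s) {a b : ℝ}
    (h : ∀ s ≤ 0, a * s + b < f s ∨ a * s + b < g s) {p q : ℝ} (hpq : p < q) (hq : q ≤ 0)
    (hp : f p ≤ a * p + b) (hq' : g q ≤ a * q + b) :
    ∃ t ∈ Icc (0 : ℝ) 1, ∀ s ≤ 0, a * s + b ≤ t * f s + (1 - t) * g s := by
  have hp' : a * p + b < g p := (h p (hpq.le.trans hq)).resolve_left (not_lt.2 hp)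
  have hfq : a * q + b < f q := (h q hq).resolve_right (not_lt.2 hq')
  obtain ⟨c, hc, hce⟩ := intermediate_value_Icc (f := fun s => f s - g s) hpq.le
    (fun s hs => ((hfd s (hs.2.trans hq)).continuousAt.sub
      (hgd s (hs.2.trans hq)).continuousAt).continuousWithinAt)
    (show (0 : ℝ) ∈ Icc (f p - g p) (f q - g q) from ⟨by linarith, by linarith⟩)
  have hfg : f c = g c := sub_eq_zero.1 hce
  have hc0 : c ≤ 0 := hc.2.trans hq
  have hfc : a * c + b < f c := by
    rcases h c hc0 with h | h <;> linarith
  have hmem : ∀ s ≤ (0 : ℝ), s ∈ Iio (1 : ℝ) := fun s hs => lt_of_le_of_lt hs one_pos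
  have htf := fun s (hs : s ≤ 0) => hf.add_deriv_mul_sub_le (hmem c hc0) (hmem s hs) (hfd c hc0)
  have htg := fun s (hs : s ≤ 0) => hg.add_deriv_mul_sub_le (hmem c hc0) (hmem s hs) (hgd c hc0)
  set A := deriv f c
  set B := deriv g c
  have hA : a < A := by
    have h1 := htf p (hpq.le.trans hq)
    by_contra! hle
    linarith [mul_nonneg (sub_nonneg.2 hle) (sub_nonneg.2 hc.1)]
  have hB : B < a := by
    have h1 := htg q hq
    by_contra! hle
    linarith [mul_nonneg (sub_nonneg.2 hle) (sub_nonneg.2 hc.2)]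
  have hAB : 0 < A - B := by linarith
  have ht0 : 0 ≤ (a - B) / (A - B) := div_nonneg (by linarith) hAB.le
  have ht1 : (a - B) / (A - B) ≤ 1 := (div_le_one hAB).2 (by linarith)
  refine ⟨(a - B) / (A - B), ⟨ht0, ht1⟩, fun s hs => ?_⟩
  set t := (a - B) / (A - B) with ht
  have hslope : t * A + (1 - t) * B = a := by
    rw [ht]; field_simp; ring
  have h1 := mul_le_mul_of_nonneg_left (htf s hs) ht0
  have h2 := mul_le_mul_of_nonneg_left (htg s hs) (sub_nonneg.2 ht1)
  have h3 : t * (f c + A * (s - c)) + (1 - t) * (g c + B * (s - c)) = f c + a * (s - c) := by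
    rw [← hfg, ← hslope]; ring
  linarith

theorem exists_convexCombination_line_le [Nonempty ι] (hconv : ∀ i, ConvexOn ℝ (Iio 1) (φ i))
    (hd : ∀ i, ∀ s ≤ 0, DifferentiableAt ℝ (φ i) s) (h0 : ∀ i, φ i 0 = 0)
    (hV : ∀ s ≤ 0, ∀ a < (V - r) * s - V, ∃ i, a < φ i s) (hVV : V < V') :
    ∃ i j, ∃ t ∈ Icc (0 : ℝ) 1, ∀ s ≤ 0, (V' - r) * s - V' ≤ t * φ i s + (1 - t) * φ j s := by
  obtain ⟨i, j, hij⟩ := exists_disjoint_sublevel hconv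
    (fun i s hs => (hd i s hs).continuousAt.continuousWithinAt) h0 hV hVV
  by_cases hi : ∀ s ≤ 0, (V' - r) * s - V' < φ i s
  · exact ⟨i, i, 1, by simp, fun s hs => by simpa using (hi s hs).le⟩
  by_cases hj : ∀ s ≤ 0, (V' - r) * s - V' < φ j s
  · exact ⟨j, j, 1, by simp, fun s hs => by simpa using (hj s hs).le⟩
  push Not at hi hj
  obtain ⟨p, hp, hpi⟩ := hi
  obtain ⟨q, hq, hqj⟩ := hj
  simp only [sub_eq_add_neg _ V'] at hij hpi hqj ⊢
  rcases lt_trichotomy p q with h | h | h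
  · exact ⟨i, j, exists_convexCombination_of_lt (hconv i) (hconv j) (hd i) (hd j) hij h hq hpi hqj⟩
  · subst h
    rcases hij p hp with h | h <;> linarith
  · exact ⟨j, i, exists_convexCombination_of_lt (hconv j) (hconv i) (hd j) (hd i)
      (fun s hs => (hij s hs).symm) h hp hqj hpi⟩

end Minimax

/-! ### Two-point input laws -/

section TwoPoint

variable {X Y : Type*} [MeasurableSpace X] [MeasurableSpace Y] {W Wbar : Kernel X Y}
  [IsMarkovKernel W] [IsMarkovKernel Wbar]

/-- The level set of `z ↦ K z B` through `x` is measurable, so it contains `y`. Points that the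
σ-algebra of `X` cannot separate are thus the same input. -/
theorem eq_of_forall_measurableSet_mem {x y : X}
    (h : ∀ A, MeasurableSet A → x ∈ A → y ∈ A) (K : Kernel X Y) : K x = K y := by
  refine Measure.ext fun B hB => ?_
  have : y ∈ (fun z => K z B) ⁻¹' {K x B} :=
    h _ (K.measurable_coe hB (measurableSet_singleton _)) rfl
  exact (mem_singleton_iff.1 this).symm

theorem rnDeriv_ae_eq_of_restrict_eq {Z : Type*} [MeasurableSpace Z] {μ ν : Measure Z}
    [SigmaFinite μ] {f : Z → ℝ≥0∞} (hf : Measurable f) {S : Set Z} (hS : MeasurableSet S)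
    (hμS : μ Sᶜ = 0) (h : ν.restrict S = μ.withDensity f) : f =ᵐ[μ] ν.rnDeriv μ := by
  refine Measure.eq_rnDeriv hf (s := ν.restrict Sᶜ) ⟨S, hS, ?_, hμS⟩ ?_
  · rw [Measure.restrict_apply hS]; simp
  · rw [← h, add_comm, Measure.restrict_add_restrict_compl hS]

/-- Additivity of `Phi` for an input law with (at most) two atoms `x` and `y` that are separated by
a measurable set. -/
theorem Phi_compProd_two {P : Measure X} [IsProbabilityMeasure P] {x y : X} {a b : ℝ≥0∞}
    (hP : P = a • Measure.dirac x + b • Measure.dirac y) {A : Set X} (hA : MeasurableSet A)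
    (hx : x ∈ A) (hy : y ∉ A ∨ b = 0) (s : ℝ) :
    Phi s (P ⊗ₘ W) (P ⊗ₘ Wbar) = a * Phi s (W x) (Wbar x) + b * Phi s (W y) (Wbar y) := by
  classical
  have hint : ∀ (K : Kernel X Y) [IsMarkovKernel K] (g : X × Y → ℝ≥0∞), Measurable g →
      ∫⁻ p, g p ∂(P ⊗ₘ K) = a * ∫⁻ z, g (x, z) ∂(K x) + b * ∫⁻ z, g (y, z) ∂(K y) := by
    intro K _ g hg
    have hm : Measurable fun w => ∫⁻ z, g (w, z) ∂(K w) := hg.lintegral_kernel_prod_right'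
    rw [Measure.lintegral_compProd hg, hP, lintegral_add_measure, lintegral_smul_measure,
      lintegral_smul_measure, lintegral_dirac' _ hm, lintegral_dirac' _ hm]
    rfl
  have hyb : ∀ {u v : ℝ≥0∞}, (y ∉ A → u = v) → b * u = b * v := fun h => by
    rcases hy with hy | hb
    · rw [h hy]
    · simp [hb]
  obtain ⟨S, hS, hWS, hWbS⟩ := exists_measurableSet_restrict_eq_withDensity (W x) (Wbar x)
  obtain ⟨S', hS', hWS', hWbS'⟩ := exists_measurableSet_restrict_eq_withDensity (W y) (Wbar y)
  set D := (Wbar x).rnDeriv (W x)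
  set D' := (Wbar y).rnDeriv (W y)
  have hDm : Measurable D := Measure.measurable_rnDeriv _ _
  have hDm' : Measurable D' := Measure.measurable_rnDeriv _ _
  have hAm : MeasurableSet {p : X × Y | p.1 ∈ A} := measurable_fst hA
  -- The two conditional densities are glued along `A`; uniqueness of the Lebesgue decomposition
  -- identifies `E` with the joint density. If `b = 0`, the values of `E` over `y` do not matter.
  set E : X × Y → ℝ≥0∞ := fun p => if p.1 ∈ A then D p.2 else D' p.2 with hE
  have hEm : Measurable E :=
    Measurable.ite hAm (hDm.comp measurable_snd) (hDm'.comp measurable_snd)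
  set T : Set (X × Y) := (A ×ˢ S) ∪ (Aᶜ ×ˢ S') with hT
  have hTm : MeasurableSet T := (hA.prod hS).union (hA.compl.prod hS')
  have hTx : ∀ z, (x, z) ∈ T ↔ z ∈ S := fun z => by simp [hT, hx]
  have hTy : y ∉ A → ∀ z, (y, z) ∈ T ↔ z ∈ S' := fun h z => by simp [hT, h]
  have hμT : (P ⊗ₘ W) Tᶜ = 0 := by
    rw [← lintegral_indicator_one hTm.compl, hint W _ (measurable_one.indicator hTm.compl)]
    have h1 : ∫⁻ z, Tᶜ.indicator 1 (x, z) ∂(W x) = 0 := by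
      rw [← hWS, ← lintegral_indicator_one hS.compl]
      refine lintegral_congr fun z => ?_
      simp [indicator, hTx]
    have h2 : b * ∫⁻ z, Tᶜ.indicator 1 (y, z) ∂(W y) = b * 0 := hyb fun h => by
      rw [← hWS', ← lintegral_indicator_one hS'.compl]
      refine lintegral_congr fun z => ?_
      simp [indicator, hTy h]
    rw [h1, h2]; simp
  have hνT : (P ⊗ₘ Wbar).restrict T = (P ⊗ₘ W).withDensity E := by
    refine Measure.ext_of_lintegral _ fun g hg => ?_
    have hgx : Measurable fun z => g (x, z) := hg.comp measurable_prodMk_left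
    have hgy : Measurable fun z => g (y, z) := hg.comp measurable_prodMk_left
    rw [← lintegral_indicator hTm, hint Wbar _ (hg.indicator hTm),
      lintegral_withDensity_eq_lintegral_mul _ hEm hg, hint W _ (hEm.mul hg)]
    congr 1
    · congr 1
      calc ∫⁻ z, T.indicator g (x, z) ∂(Wbar x)
          = ∫⁻ z, S.indicator (fun z => g (x, z)) z ∂(Wbar x) :=
            lintegral_congr fun z => by simp [indicator, hTx]
        _ = ∫⁻ z, (D * fun z => g (x, z)) z ∂(W x) := by
            rw [lintegral_indicator hS, hWbS, lintegral_withDensity_eq_lintegral_mul _ hDm hgx]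
        _ = _ := lintegral_congr fun z => by simp [hE, hx]
    · refine hyb fun h => ?_
      calc ∫⁻ z, T.indicator g (y, z) ∂(Wbar y)
          = ∫⁻ z, S'.indicator (fun z => g (y, z)) z ∂(Wbar y) :=
            lintegral_congr fun z => by simp [indicator, hTy h]
        _ = ∫⁻ z, (D' * fun z => g (y, z)) z ∂(W y) := by
            rw [lintegral_indicator hS', hWbS', lintegral_withDensity_eq_lintegral_mul _ hDm' hgy]
        _ = _ := lintegral_congr fun z => by simp [hE, h]
  have hae := rnDeriv_ae_eq_of_restrict_eq hEm hTm hμT hνT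
  calc Phi s (P ⊗ₘ W) (P ⊗ₘ Wbar) = ∫⁻ p, E p ^ s ∂(P ⊗ₘ W) :=
        lintegral_congr_ae (hae.mono fun p hp => by simp only [hp])
    _ = a * ∫⁻ z, E (x, z) ^ s ∂(W x) + b * ∫⁻ z, E (y, z) ^ s ∂(W y) :=
        hint W _ (hEm.pow_const s)
    _ = _ := by
        congr 1
        · simp [hE, hx, Phi, D]
        · exact hyb fun h => by simp [hE, h, Phi, D']

/-- For inseparable `x` and `y` the two terms on the right share the same `Phi`, so a single atom at
`x` does. -/
theorem exists_twoPoint_Phi_eq (x y : X) {t : ℝ} (ht : t ∈ Icc (0 : ℝ) 1) :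
    ∃ P ∈ twoPoint X, ∀ s, Phi s ((P : Measure X) ⊗ₘ W) ((P : Measure X) ⊗ₘ Wbar) =
      ENNReal.ofReal t * Phi s (W x) (Wbar x) + ENNReal.ofReal (1 - t) * Phi s (W y) (Wbar y) := by
  have hprob : ∀ {u : ℝ} (_ : u ∈ Icc (0 : ℝ) 1), IsProbabilityMeasure
      (ENNReal.ofReal u • Measure.dirac x + ENNReal.ofReal (1 - u) • Measure.dirac y) := fun hu =>
    ⟨by simp [← ENNReal.ofReal_add hu.1 (sub_nonneg.2 hu.2)]⟩
  by_cases hsep : ∃ A, MeasurableSet A ∧ x ∈ A ∧ y ∉ A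
  · obtain ⟨A, hA, hx, hy⟩ := hsep
    let P : ProbabilityMeasure X := ⟨_, hprob ht⟩
    exact ⟨P, ⟨x, y, t, ht, rfl⟩, Phi_compProd_two (P := P) rfl hA hx (Or.inl hy)⟩
  · push Not at hsep
    have h1 : (1 : ℝ) ∈ Icc (0 : ℝ) 1 := by simp
    let P : ProbabilityMeasure X := ⟨_, hprob h1⟩
    refine ⟨P, ⟨x, y, 1, h1, rfl⟩, fun s => ?_⟩
    refine (Phi_compProd_two (W := W) (Wbar := Wbar) (P := P) rfl MeasurableSet.univ
      (mem_univ x) (Or.inr (by simp)) s).trans ?_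
    rw [← eq_of_forall_measurableSet_mem hsep W, ← eq_of_forall_measurableSet_mem hsep Wbar,
      ← add_mul, ← add_mul, ← ENNReal.ofReal_add ht.1 (sub_nonneg.2 ht.2)]
    simp

theorem exists_twoPoint_hanKobayashi_le [Nonempty X]
    (hfin : ∀ x : X, ∀ s : ℝ, s ≤ 0 → Phi s (W x) (Wbar x) < ⊤) {r V V' : ℝ}
    (hV : hanKobayashi r (fun s => phiSup s W Wbar) ≤ V) (hVV : V < V') :
    ∃ P ∈ twoPoint X,
      (∀ s ≤ 0, Phi s ((P : Measure X) ⊗ₘ W) ((P : Measure X) ⊗ₘ Wbar) < ⊤) ∧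
      hanKobayashi r (fun s => phiInput s W Wbar P) ≤ V' := by
  rw [hanKobayashi_le_iff] at hV
  obtain ⟨x, y, t, ht, hxy⟩ := exists_convexCombination_line_le
    (φ := fun x => cgf (llr (Wbar x) (W x)) (W x)) (r := r)
    (fun x => convexOn_cgf_llr (hfin x))
    (fun x s hs => (analyticAt_cgf (Iio_one_subset_interior_integrableExpSet (hfin x)
      (show s < 1 by linarith))).differentiableAt)
    (fun x => cgf_zero)
    (fun s hs a ha => by
      obtain ⟨x, hx⟩ := lt_iSup_iff.1 ((EReal.coe_lt_coe_iff.2 ha).trans_le (hV s hs))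
      rw [phi_eq_cgf (hfin x) hs, EReal.coe_lt_coe_iff] at hx
      exact ⟨x, hx⟩) hVV
  obtain ⟨P, hP, hΦ⟩ := exists_twoPoint_Phi_eq (W := W) (Wbar := Wbar) x y ht
  refine ⟨P, hP, fun s hs => ?_, (hanKobayashi_le_iff r V' _).2 fun s hs => ?_⟩
  · rw [hΦ]
    exact ENNReal.add_lt_top.2 ⟨ENNReal.mul_lt_top ENNReal.ofReal_lt_top (hfin x s hs),
      ENNReal.mul_lt_top ENNReal.ofReal_lt_top (hfin y s hs)⟩
  · have hexp : ∀ x, Phi s (W x) (Wbar x) =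
        ENNReal.ofReal (Real.exp (cgf (llr (Wbar x) (W x)) (W x) s)) := fun x => by
      rw [← ENNReal.log_eq_iff, log_ofReal_exp]
      exact phi_eq_cgf (hfin x) hs
    rw [phiInput, phi, hΦ, hexp, hexp, ← log_ofReal_exp, ENNReal.log_le_log_iff,
      ← ENNReal.ofReal_mul ht.1, ← ENNReal.ofReal_mul (sub_nonneg.2 ht.2),
      ← ENNReal.ofReal_add (mul_nonneg ht.1 (Real.exp_pos _).le)
        (mul_nonneg (sub_nonneg.2 ht.2) (Real.exp_pos _).le)]
    refine ENNReal.ofReal_le_ofReal ((Real.exp_le_exp.2 (hxy s hs)).trans ?_)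
    -- Jensen: the logarithm of the mixture of exponentials dominates the mixture of the exponents.
    exact convexOn_exp.2 (mem_univ _) (mem_univ _) ht.1 (sub_nonneg.2 ht.2) (by ring)

theorem iInf_twoPoint_le_hanKobayashi_phiSup [Nonempty X]
    (hfin : ∀ x : X, ∀ s : ℝ, s ≤ 0 → Phi s (W x) (Wbar x) < ⊤) (r : ℝ) :
    (⨅ P ∈ twoPoint X, hanKobayashi r (fun s => phiInput s W Wbar P)) ≤
        hanKobayashi r (fun s => phiSup s W Wbar) ∧
      (⨅ P ∈ twoPoint X, nonAdaptiveExponent r W Wbar P) ≤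
        hanKobayashi r (fun s => phiSup s W Wbar) := by
  have key : ∀ V' : ℝ, hanKobayashi r (fun s => phiSup s W Wbar) < V' → ∃ P ∈ twoPoint X,
      hanKobayashi r (fun s => phiInput s W Wbar P) ≤ V' ∧
        nonAdaptiveExponent r W Wbar P ≤ V' := fun V' hV' => by
    obtain ⟨V, hV, hVV⟩ := EReal.lt_iff_exists_real_btwn.1 hV'
    obtain ⟨P, hP, hΦ, hle⟩ :=
      exists_twoPoint_hanKobayashi_le hfin hV.le (EReal.coe_lt_coe_iff.1 hVV)
    exact ⟨P, hP, hle, (nonAdaptiveExponent_le P hΦ r).trans hle⟩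
  refine ⟨EReal.le_of_forall_lt_iff_le.1 fun V' hV' => ?_,
    EReal.le_of_forall_lt_iff_le.1 fun V' hV' => ?_⟩ <;>
  obtain ⟨P, hP, h1, h2⟩ := key V' hV'
  · exact iInf₂_le_of_le P hP h1
  · exact iInf₂_le_of_le P hP h2

theorem strongConverseExponent_le_nonAdaptiveExponent (r : ℝ) (W Wbar : Kernel X Y)
    (P : ProbabilityMeasure X) :
    strongConverseExponent r W Wbar ≤ nonAdaptiveExponent r W Wbar P :=
  le_iInf fun M => le_iInf fun _ => le_iInf fun hM => iInf₂_le M hM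

end TwoPoint

end ChannelDiscrimination

/-! ### The chain of inequalities closes -/

theorem theorem3 {X Y : Type*} [MeasurableSpace X] [MeasurableSpace Y] [Nonempty X]
    (W Wbar : Kernel X Y) [IsMarkovKernel W] [IsMarkovKernel Wbar]
    (hfin : ∀ x : X, ∀ s : ℝ, s ≤ 0 → Phi s (W x) (Wbar x) < ⊤)
    (hC1 : ∀ x : X, ContDiffOn ℝ 1 (fun s : ℝ => (phi s (W x) (Wbar x)).toReal) (Iic 0))
    (r : ℝ) :
    strongConverseExponent r W Wbar = hanKobayashi r (fun s => phiSup s W Wbar) ∧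
    strongConverseExponent r W Wbar =
      ⨅ P : ProbabilityMeasure X, hanKobayashi r (fun s => phiInput s W Wbar P) ∧
    strongConverseExponent r W Wbar =
      ⨅ P ∈ twoPoint X, hanKobayashi r (fun s => phiInput s W Wbar P) ∧
    strongConverseExponent r W Wbar = ⨅ P ∈ twoPoint X, nonAdaptiveExponent r W Wbar P := by
  have hlow : hanKobayashi r (fun s => phiSup s W Wbar) ≤ strongConverseExponent r W Wbar :=
    le_iInf₂ fun M hM => hanKobayashi_phiSup_le_rate M hM
  obtain ⟨hHK, hnon⟩ := iInf_twoPoint_le_hanKobayashi_phiSup hfin r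
  have hup : strongConverseExponent r W Wbar ≤ ⨅ P ∈ twoPoint X, nonAdaptiveExponent r W Wbar P :=
    le_iInf₂ fun P _ => strongConverseExponent_le_nonAdaptiveExponent r W Wbar P
  have heq : strongConverseExponent r W Wbar = hanKobayashi r (fun s => phiSup s W Wbar) :=
    le_antisymm (hup.trans hnon) hlow
  have hall : hanKobayashi r (fun s => phiSup s W Wbar) ≤
      ⨅ P : ProbabilityMeasure X, hanKobayashi r (fun s => phiInput s W Wbar P) :=
    le_iInf fun P => hanKobayashi_anti fun s hs => phiInput_le_phiSup hs P
  have htwo : (⨅ P : ProbabilityMeasure X, hanKobayashi r (fun s => phiInput s W Wbar P)) ≤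
      ⨅ P ∈ twoPoint X, hanKobayashi r (fun s => phiInput s W Wbar P) :=
    le_iInf₂ fun P _ => iInf_le _ P
  refine ⟨heq, ?_, ?_, le_antisymm hup (hnon.trans hlow)⟩
  · exact heq.trans (le_antisymm hall (htwo.trans hHK))
  · exact heq.trans (le_antisymm (hall.trans htwo) hHK)
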